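/- **Setting.** Let $\mathbf X=\langle X_t\rangle_{t\ge1}$ be a stationary ergodic (not necessarily mixing) process with values in $[0,1]$: $\mu$ is a probability measure on $[0,1]^{\mathbb N}$ (product Borel $\sigma$-algebra), $X_t$ are the coordinate maps, and the left shift preserves $\mu$ and is ergodic. For sub-$\sigma$-algebras put $\alpha(\mathfrak U,\mathfrak V)=\sup_{U\in\mathfrak U,V\in\mathfrak V}|\mu(U\cap V)-\mu(U)\mu(V)|$. The $\alpha$-mixing coefficients are $\alpha(m)=\sup_{j\ge1}\alpha\big(\sigma(X_1,\dots,X_j),\sigma(X_t:t\ge j+m)\big)$, $m\ge1$, and $\|\boldsymbol\alpha\|=\sum_{m\ge1}\alpha(m)\in[0,\infty]$. **Empirical coefficients.** For $k,\ell\ge1$ let $\mathcal D_{k,\ell}$ be the collection of all unions of dyadic cubes of side $2^{-\ell}$ in $[0,1]^k$, i.e. of products of intervals $[\frac i{2^\ell},\frac{i+1}{2^\ell})$, $0\le i<2^\ell$, where the last interval ($i=2^\ell-1$) is closed at $1$. For $N\ge1$ and $B\subseteq[0,1]^k$ put $\mu_N(B)=\frac1N\sum_{i=0}^{N-1}\mathbf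 1_B(X_{ik+1},\dots,X_{(i+1)k})$. For $m\ge1$, $1\le j\le n-m$ and $j'=n-m-j+1$ put $$\gamma_N^{j}(A,B)=\frac1N\sum_{i=0}^{N-1}\mathbf 1_A(X_{in+1},\dots,X_{in+j})\,\mathbf 1_B(X_{in+j+m},\dots,X_{(i+1)n}),$$ $$\widehat\alpha_{N,n}^{\ell}(m)=\max_{1\le j\le n-m}\ \max_{A\in\mathcal D_{j,\ell},\,B\in\mathcal D_{j',\ell}}\big|\gamma_N^{j}(A,B)-\mu_N(A)\mu_N(B)\big|,$$ with $\widehat\alpha_{N,n}^{\ell}(m)=0$ if $n\le m$. **Parameters.** Let $\langle\ell_t\rangle,\langle n_t\rangle,\langle M_t\rangle$ be non-decreasing unbounded sequences of positive integers, let $\delta_t>0$ with $\sum_t\delta_t<\infty$, and let $\epsilon_t>0$ with $\epsilon_t\to0$. With $C_{m,\ell,n}=m\,2^{2^{n\ell}+2^{m\ell+1}+1}$ put $$\kappa_t=\Big\lceil\frac{C_{M_t,\ell_t,n_t}}{\epsilon_t^2\,\delta_t}\Big\rceil,\qquad \theta_t=\sum_{m=1}^{M_t}\widehat\alpha_{\kappa_t,n_t}^{\ell_t}(m).$$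 **Estimator.** Let $\mathcal S$ be a countable dense subset of $[0,\infty)$ and let $\langle u_t\rangle$ be a sequence in $\mathcal S$ that takes every value $s\in\mathcal S$ infinitely often. Put $b_0(s)=1$ for $s\in\mathcal S$ and, for $t\ge1$, $$b_t(s)=\begin{cases}1&\text{if }u_t=s\text{ and }\theta_t\le s+\epsilon_t\sqrt s,\\0&\text{if }u_t=s\text{ and }\theta_t>s+\epsilon_t\sqrt s,\\b_{t-1}(s)&\text{if }u_t\ne s.\end{cases}$$ Let $\xi_0=0$ and, for $t\ge1$, let $\xi_t=\inf\{s\in\{u_1,\dots,u_t\}:b_t(s)=1\}\in[0,\infty]$, the infimum of the thresholds tested so far whose latest test did not reject (with $\inf\emptyset=\infty$). **Theorem.** For every choice of these parameters and every stationary ergodic process $\mathbf X$, $$\lim_{t\to\infty}\xi_t=\|\boldsymbol\alpha\|\qquad\mu\text{-almost surely},$$ where the limit is in $[0,\infty]$; in particular $\xi_t\to\infty$ almost surely if $\|\boldsymbol\alpha\|=\infty$. -/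

import Mathlib

open MeasureTheory Filter Topology
open scoped NNReal ENNReal unitInterval

namespace AlphaMixing

/-- Trajectories of a `[0,1]`-valued process. Coordinates are numbered from `0` in the code: the
random variable `X_t`, `t ≥ 1`, is `fun ω => ω (t - 1)`. -/
abbrev Path : Type := ℕ → I

/-- The left shift `(a₁, a₂, …) ↦ (a₂, a₃, …)`. -/
def shift (ω : Path) : Path := fun i => ω (i + 1)

/-! ### The mixing coefficients -/

/-- Rosenblatt's coefficient `α(𝔘, 𝔙) = sup |μ (U ∩ V) - μ U * μ V|`. -/
noncomputable def alphaDep {Ω : Type*} [MeasurableSpace Ω] (μ : Measure Ω)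
    (mU mV : MeasurableSpace Ω) : ℝ≥0∞ :=
  ⨆ (U : Set Ω) (_ : MeasurableSet[mU] U) (V : Set Ω) (_ : MeasurableSet[mV] V),
    ENNReal.ofReal |μ.real (U ∩ V) - μ.real U * μ.real V|

/-- `σ(X_1, …, X_j)`. -/
abbrev past (j : ℕ) : MeasurableSpace Path :=
  ⨆ (i : ℕ) (_ : i + 1 ≤ j), MeasurableSpace.comap (fun ω : Path => ω i) inferInstance

/-- `σ(X_t : t ≥ a)`. -/
abbrev future (a : ℕ) : MeasurableSpace Path :=
  ⨆ (i : ℕ) (_ : a ≤ i + 1), MeasurableSpace.comap (fun ω : Path => ω i) inferInstance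

/-- `α(m) = sup_{j ≥ 1} α(σ(X_1, …, X_j), σ(X_t : t ≥ j + m))`. -/
noncomputable def alpha (μ : Measure Path) (m : ℕ) : ℝ≥0∞ :=
  ⨆ (j : ℕ) (_ : 1 ≤ j), alphaDep μ (past j) (future (j + m))

/-- The norm `‖α‖ = ∑_{m ≥ 1} α(m)`, in `[0, ∞]`. -/
noncomputable def alphaNorm (μ : Measure Path) : ℝ≥0∞ := ∑' m : ℕ, alpha μ (m + 1)

/-! ### Dyadic cubes -/

/-- The dyadic interval `[i / 2^ℓ, (i + 1) / 2^ℓ)`; the last one, `i = 2^ℓ - 1`, also contains its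
right end point `1`, so that the intervals of level `ℓ` partition `[0,1]`. -/
def dyadicInterval (ℓ : ℕ) (i : Fin (2 ^ ℓ)) : Set I :=
  {x | (i : ℝ) / 2 ^ ℓ ≤ (x : ℝ) ∧
    ((x : ℝ) < ((i : ℝ) + 1) / 2 ^ ℓ ∨ ((i : ℕ) + 1 = 2 ^ ℓ ∧ (x : ℝ) = 1))}

/-- The dyadic cube of side length `2^{-ℓ}` in `[0,1]^k` with index `i`. -/
def dyadicCube (k ℓ : ℕ) (i : Fin k → Fin (2 ^ ℓ)) : Set (Fin k → I) :=
  {x | ∀ r, x r ∈ dyadicInterval ℓ (i r)}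

/-- The sets of cubes of level `ℓ` in `[0,1]^k`, each cube being given by its index. -/
abbrev CubeSet (k ℓ : ℕ) : Type := Finset (Fin k → Fin (2 ^ ℓ))

/-- The subset of `[0,1]^k` covered by a set of cubes. -/
def CubeSet.toSet {k ℓ : ℕ} (A : CubeSet k ℓ) : Set (Fin k → I) :=
  ⋃ i ∈ A, dyadicCube k ℓ i

/-! ### The empirical coefficients -/

/-- The block `(X_{a+1}, …, X_{a+k})` of a trajectory. -/
def block (ω : Path) (a k : ℕ) : Fin k → I := fun r => ω (a + r)

/-- The empirical measure
`μ_t(X, B) = (1/t) ∑_{i < t} 1_B(X_{ik+1}, …, X_{(i+1)k})` of `B ⊆ [0,1]^k`. -/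
noncomputable def empMeasure (ω : Path) (t : ℕ) {k : ℕ} (B : Set (Fin k → I)) : ℝ :=
  (1 / (t : ℝ)) * ∑ i ∈ Finset.range t, B.indicator (fun _ => (1 : ℝ)) (block ω (i * k) k)

/-- The empirical joint frequency
`γ(A, B) = (1/t) ∑_{i < t} 1_A(X_{in+1}, …, X_{in+j}) 1_B(X_{in+j+m}, …, X_{(i+1)n})`,
for `A ⊆ [0,1]^j`, `B ⊆ [0,1]^{j'}`; it is used for `j ≥ 1` and `j' = n - m - j + 1`. -/
noncomputable def empJoint (ω : Path) (t n m : ℕ) {j j' : ℕ}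
    (A : Set (Fin j → I)) (B : Set (Fin j' → I)) : ℝ :=
  (1 / (t : ℝ)) * ∑ i ∈ Finset.range t,
    A.indicator (fun _ => (1 : ℝ)) (block ω (i * n) j) *
      B.indicator (fun _ => (1 : ℝ)) (block ω (i * n + (j + m - 1)) j')

/-- The empirical coefficient of lag `m` computed from `t` blocks of length `n` at resolution `ℓ`:
the maximum of `|γ(A, B) - μ_t(A) μ_t(B)|` over `1 ≤ j ≤ n - m` and over the unions `A`, `B` of
dyadic cubes of level `ℓ` in `[0,1]^j` and `[0,1]^{j'}`, where `j' = n - m - j + 1`.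
It is `0` if `n ≤ m`, when there is no such `j`. -/
noncomputable def alphaHat (ω : Path) (t n ℓ m : ℕ) : ℝ≥0 :=
  (Finset.Icc 1 (n - m)).sup fun j =>
    (Finset.univ : Finset (CubeSet j ℓ)).sup fun A =>
      (Finset.univ : Finset (CubeSet (n - m - j + 1) ℓ)).sup fun B =>
        Real.nnabs (empJoint ω t n m A.toSet B.toSet
          - empMeasure ω t A.toSet * empMeasure ω t B.toSet)

/-! ### The estimators -/

/-- `C_{m,ℓ,n} = m 2^{2^{nℓ} + 2^{mℓ+1} + 1}`. -/
def constC (m ℓ n : ℕ) : ℕ := m * 2 ^ (2 ^ (n * ℓ) + 2 ^ (m * ℓ + 1) + 1)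

/-- The number of blocks `κ_t = C_{M_t,ℓ_t,n_t} / (ε_t² δ_t)`, rounded up to an integer. -/
noncomputable def kappa (ℓ n M : ℕ → ℕ) (ε δ : ℕ → ℝ) (t : ℕ) : ℕ :=
  ⌈(constC (M t) (ℓ t) (n t) : ℝ) / (ε t ^ 2 * δ t)⌉₊

/-- `θ_t(X) = ∑_{m=1}^{M_t} α̂(m)`, from `κ_t` blocks of length `n_t` at resolution `ℓ_t`. -/
noncomputable def theta (ℓ n M : ℕ → ℕ) (ε δ : ℕ → ℝ) (t : ℕ) (ω : Path) : ℝ :=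
  ∑ m ∈ Finset.Icc 1 (M t), (alphaHat ω (kappa ℓ n M ε δ t) (n t) (ℓ t) m : ℝ)

/-- The bit `b_t(s)`: the outcome of the latest test of the threshold `s` up to time `t`, where
`1` stands for `θ ≤ s + ε √s` and `0` for rejection. -/
noncomputable def bit (ℓ n M : ℕ → ℕ) (ε δ : ℕ → ℝ) (u : ℕ → ℝ≥0) (ω : Path) :
    ℕ → ℝ≥0 → ℕ
  | 0, _ => 1
  | t + 1, s =>
    if u (t + 1) = s then
      if theta ℓ n M ε δ (t + 1) ω ≤ (s : ℝ) + ε (t + 1) * √(s : ℝ) then 1 else 0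
    else bit ℓ n M ε δ u ω t s

/-- The estimator `ξ_t(X)`: the infimum of those thresholds in `S`, among the ones tested so far,
whose latest test did not reject. It is `∞` if every threshold tested so far is rejected. -/
noncomputable def xi (ℓ n M : ℕ → ℕ) (ε δ : ℕ → ℝ) (S : Set ℝ≥0) (u : ℕ → ℝ≥0)
    (t : ℕ) (ω : Path) : ℝ≥0∞ :=
  if t = 0 then 0
  else ⨅ (s : ℝ≥0) (_ : s ∈ S) (_ : ∃ i, 1 ≤ i ∧ i ≤ t ∧ u i = s)
    (_ : bit ℓ n M ε δ u ω t s = 1), (s : ℝ≥0∞)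

end AlphaMixing

/-! The sums `theta` converge almost surely to the norm, in `[0, ∞]`; the sequence of tests then
turns this into convergence of `xi` (`tendsto_xi`). The two halves of the convergence have different
proofs.

Upper bound, trivial for infinite norm. Summable coefficients bound the covariances of the block
indicators, so the frequency of a cylinder event over `N` blocks has variance at most `(1 + 2‖α‖) /
N`. A weighted sum of squares, `sqDev`, controls all cylinder events at once. The size of `kappa`
makes its expectation, multiplied by `M t ^ 2`, summable in `t`, so the total estimation error over
`M t` lags tends to `0`.

Lower bound. Powers of the shift need not be ergodic, so frequencies along blocks of length `n t`
may fail to approach the measure. Suppose however that the empirical sum stays below `K` at certain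
large times. Some lag among the first `M₀` then has empirical coefficient at most `K / M₀`; testing
it with the whole space as future event shows that the frequencies of `E` along steps `n t` and `q`
are close, for all admissible `q`. One step at which the frequency is near `μ E` therefore anchors
all the others. Such steps are primes `p`: centred projections of a function onto the invariant
functions of different prime powers of the map are orthogonal, so by Bessel's inequality they tend
to `0`. At those times the empirical coefficients thus dominate the true ones up to small errors,
and the partial sums of the true ones are at most `K`. -/

namespace AlphaMixing

/-! ### The pointwise ergodic theorem -/

section Birkhoff

variable {Ω : Type*} {T : Ω → Ω}

/-- The running maxima `max (0, S₁ φ, …, Sₙ φ)` of the Birkhoff sums. -/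
noncomputable def maxBirkhoffSum (T : Ω → Ω) (φ : Ω → ℝ) : ℕ → Ω → ℝ
  | 0 => fun _ => 0
  | n + 1 => fun ω => max 0 (φ ω + maxBirkhoffSum T φ n (T ω))

theorem maxBirkhoffSum_nonneg (φ : Ω → ℝ) (n : ℕ) (ω : Ω) : 0 ≤ maxBirkhoffSum T φ n ω := by
  cases n with
  | zero => exact le_rfl
  | succ n => exact le_max_left _ _

theorem maxBirkhoffSum_le_succ (φ : Ω → ℝ) (n : ℕ) (ω : Ω) :
    maxBirkhoffSum T φ n ω ≤ maxBirkhoffSum T φ (n + 1) ω := by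
  induction n generalizing ω with
  | zero => exact maxBirkhoffSum_nonneg φ 1 ω
  | succ n ih => exact max_le_max le_rfl (add_le_add le_rfl (ih (T ω)))

theorem maxBirkhoffSum_mono (φ : Ω → ℝ) (ω : Ω) : Monotone fun n => maxBirkhoffSum T φ n ω :=
  monotone_nat_of_le_succ fun n => maxBirkhoffSum_le_succ φ n ω

theorem birkhoffSum_le_maxBirkhoffSum (φ : Ω → ℝ) (n : ℕ) (ω : Ω) :
    birkhoffSum T φ n ω ≤ maxBirkhoffSum T φ n ω := by
  induction n generalizing ω with
  | zero => simp [maxBirkhoffSum]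
  | succ n ih =>
    rw [birkhoffSum_succ']
    exact (add_le_add le_rfl (ih (T ω))).trans (le_max_right _ _)

/-- Passing from `ω` to `T ω` shifts the index by one and changes the sums by the finite amount `φ
ω`. The invariance is exact, so the set belongs to the invariant σ-algebra. -/
theorem preimage_unbounded_birkhoffSum (φ : Ω → ℝ) :
    T ⁻¹' {ω | ∀ c : ℕ, ∃ n, (c : ℝ) < birkhoffSum T φ n ω}
      = {ω | ∀ c : ℕ, ∃ n, (c : ℝ) < birkhoffSum T φ n ω} := by
  ext ω
  simp only [Set.mem_preimage, Set.mem_ofPred_eq]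
  constructor
  · intro h c
    obtain ⟨d, hd⟩ := exists_nat_gt ((c : ℝ) - φ ω)
    obtain ⟨n, hn⟩ := h d
    exact ⟨n + 1, by rw [birkhoffSum_succ']; linarith⟩
  · intro h c
    -- The absolute value makes `d` positive, which rules out the empty sum `n = 0` below.
    obtain ⟨d, hd⟩ := exists_nat_gt ((c : ℝ) + |φ ω|)
    obtain ⟨n, hn⟩ := h d
    have hφ := le_abs_self (φ ω)
    have hφ0 := abs_nonneg (φ ω)
    have hc : (0 : ℝ) ≤ c := c.cast_nonneg
    cases n with
    | zero => simp only [birkhoffSum_zero] at hn; linarith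
    | succ n => exact ⟨n, by rw [birkhoffSum_succ'] at hn; linarith⟩

variable [MeasurableSpace Ω] {μ : Measure Ω}

theorem measurable_maxBirkhoffSum (hT : Measurable T) {φ : Ω → ℝ} (hφ : Measurable φ) (n : ℕ) :
    Measurable (maxBirkhoffSum T φ n) := by
  induction n with
  | zero => exact measurable_const
  | succ n ih => exact measurable_const.max (hφ.add (ih.comp hT))

theorem integrable_maxBirkhoffSum (hT : MeasurePreserving T μ μ) {φ : Ω → ℝ}
    (hφ : Integrable φ μ) (n : ℕ) : Integrable (maxBirkhoffSum T φ n) μ := by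
  induction n with
  | zero => exact integrable_zero _ _ _
  | succ n ih =>
    exact (integrable_zero _ _ _).sup (hφ.add (hT.integrable_comp_of_integrable ih))

/-- The maximal ergodic inequality on an invariant set. -/
theorem setIntegral_nonneg_of_maxBirkhoffSum_pos (hT : MeasurePreserving T μ μ) {φ : Ω → ℝ}
    (hφm : Measurable φ) (hφ : Integrable φ μ) {E : Set Ω} (hE : MeasurableSet E)
    (hTE : T ⁻¹' E = E) (n : ℕ) :
    0 ≤ ∫ ω in E ∩ {ω | 0 < maxBirkhoffSum T φ n ω}, φ ω ∂μ := by
  cases n with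
  | zero => simp [maxBirkhoffSum]
  | succ n =>
    set P := {ω | 0 < maxBirkhoffSum T φ (n + 1) ω}
    have hP : MeasurableSet P :=
      measurableSet_lt measurable_const (measurable_maxBirkhoffSum hT.measurable hφm _)
    have hint := integrable_maxBirkhoffSum hT hφ
    have hcomp : Integrable (fun ω => maxBirkhoffSum T φ n (T ω)) μ :=
      hT.integrable_comp_of_integrable (hint n)
    -- Garsia's argument: where the maximum is positive, `φ` is the `(n + 1)`-st maximum minus the
    -- `n`-th one at `T ω`. Extending both integrals to `E` only lowers the difference, and
    -- invariance together with monotonicity in `n` makes it nonnegative.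
    have h1 : ∫ ω in E ∩ P, φ ω ∂μ = ∫ ω in E ∩ P, maxBirkhoffSum T φ (n + 1) ω ∂μ
        - ∫ ω in E ∩ P, maxBirkhoffSum T φ n (T ω) ∂μ := by
      rw [← integral_sub (hint _).integrableOn hcomp.integrableOn]
      refine setIntegral_congr_fun (hE.inter hP) fun ω hω => ?_
      have h0 : 0 < max 0 (φ ω + maxBirkhoffSum T φ n (T ω)) := hω.2
      have : maxBirkhoffSum T φ (n + 1) ω = φ ω + maxBirkhoffSum T φ n (T ω) :=
        max_eq_right ((lt_max_iff.1 h0).resolve_left (lt_irrefl _)).le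
      simp only [this]; ring
    have h2 : ∫ ω in E, maxBirkhoffSum T φ (n + 1) ω ∂μ
        = ∫ ω in E ∩ P, maxBirkhoffSum T φ (n + 1) ω ∂μ := by
      refine setIntegral_eq_of_subset_of_forall_sdiff_eq_zero hE
        Set.inter_subset_left ?_
      intro ω hω
      have : ¬ 0 < maxBirkhoffSum T φ (n + 1) ω := fun h => hω.2 ⟨hω.1, h⟩
      exact le_antisymm (not_lt.1 this) (maxBirkhoffSum_nonneg _ _ _)
    have h3 : ∫ ω in E ∩ P, maxBirkhoffSum T φ n (T ω) ∂μ
        ≤ ∫ ω in E, maxBirkhoffSum T φ n (T ω) ∂μ :=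
      setIntegral_mono_set hcomp.integrableOn
        (Eventually.of_forall fun ω => maxBirkhoffSum_nonneg _ _ _)
        (Set.inter_subset_left.eventuallyLE)
    have h4 : ∫ ω in E, maxBirkhoffSum T φ n (T ω) ∂μ = ∫ ω in E, maxBirkhoffSum T φ n ω ∂μ := by
      have h := setIntegral_map (μ := μ) (g := T) (f := maxBirkhoffSum T φ n) hE
        (hT.map_eq.symm ▸ (hint n).aestronglyMeasurable) hT.aemeasurable
      rw [hT.map_eq, hTE] at h
      exact h.symm
    have h5 : ∫ ω in E, maxBirkhoffSum T φ n ω ∂μ ≤ ∫ ω in E, maxBirkhoffSum T φ (n + 1) ω ∂μ :=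
      integral_mono (hint n).integrableOn (hint _).integrableOn
        fun ω => maxBirkhoffSum_le_succ φ n ω
    linarith

/-- If the Birkhoff sums of `φ` are unbounded above on an invariant set, then the integral of `φ`
over this set is nonnegative. -/
theorem setIntegral_nonneg_of_unbounded_birkhoffSum (hT : MeasurePreserving T μ μ) {φ : Ω → ℝ}
    (hφm : Measurable φ) (hφ : Integrable φ μ) {E : Set Ω} (hE : MeasurableSet E)
    (hTE : T ⁻¹' E = E) (hpos : ∀ ω ∈ E, ∃ n, 0 < birkhoffSum T φ n ω) :
    0 ≤ ∫ ω in E, φ ω ∂μ := by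
  have hU : ⋃ n, E ∩ {ω | 0 < maxBirkhoffSum T φ n ω} = E := by
    refine Set.Subset.antisymm (Set.iUnion_subset fun n => Set.inter_subset_left) fun ω hω => ?_
    obtain ⟨n, hn⟩ := hpos ω hω
    exact Set.mem_iUnion.2 ⟨n, hω, hn.trans_le (birkhoffSum_le_maxBirkhoffSum φ n ω)⟩
  have hlim := tendsto_setIntegral_of_monotone (μ := μ) (f := φ)
    (s := fun n => E ∩ {ω | 0 < maxBirkhoffSum T φ n ω})
    (fun n => hE.inter (measurableSet_lt measurable_const
      (measurable_maxBirkhoffSum hT.measurable hφm n)))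
    (fun m n hmn => Set.inter_subset_inter_right _ fun ω (hω : 0 < _) =>
      lt_of_lt_of_le hω (maxBirkhoffSum_mono φ ω hmn)) hφ.integrableOn
  rw [hU] at hlim
  exact ge_of_tendsto' hlim fun n => setIntegral_nonneg_of_maxBirkhoffSum_pos hT hφm hφ hE hTE n

theorem measurable_birkhoffSum (hT : Measurable T) {φ : Ω → ℝ} (hφ : Measurable φ) (n : ℕ) :
    Measurable (birkhoffSum T φ n) :=
  Finset.measurable_sum _ fun i _ => hφ.comp (hT.iterate i)

/-- One half of Birkhoff's theorem, with an error term. -/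
theorem ae_eventually_birkhoffAverage_lt [IsProbabilityMeasure μ] (hT : MeasurePreserving T μ μ)
    {f : Ω → ℝ} (hfm : Measurable f) (hf : Integrable f μ) {ε : ℝ} (hε : 0 < ε) :
    ∀ᵐ ω ∂μ, ∀ᶠ n in atTop,
      birkhoffAverage ℝ T f n ω < (μ[f | MeasurableSpace.invariants T]) ω + ε := by
  have hm := MeasurableSpace.invariants_le T
  set g := μ[f | MeasurableSpace.invariants T]
  have hgm' : Measurable[MeasurableSpace.invariants T] g := stronglyMeasurable_condExp.measurable
  have hgm : Measurable g := hgm'.mono hm le_rfl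
  have hgT : g ∘ T = g := MeasurableSpace.comp_eq_of_measurable_invariants hgm'
  have hg : Integrable g μ := integrable_condExp
  -- The integral of this `φ` over the invariant set `E` is `-(ε / 2) μ E`, so the maximal
  -- inequality forces `μ E = 0`. Off `E` the sums are bounded by some `c`, and `c / n` is
  -- eventually below the other `ε / 2`.
  set φ : Ω → ℝ := fun ω => f ω - (g ω + ε / 2) with hφdef
  have hφm : Measurable φ := hfm.sub (hgm.add_const _)
  have hφ : Integrable φ μ := hf.sub (hg.add (integrable_const _))
  set E := {ω | ∀ c : ℕ, ∃ n, (c : ℝ) < birkhoffSum T φ n ω}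
  have hE : MeasurableSet E := by
    simp only [E, Set.ofPred_forall, Set.ofPred_exists]
    exact MeasurableSet.iInter fun c => MeasurableSet.iUnion fun n =>
      measurableSet_lt measurable_const (measurable_birkhoffSum hT.measurable hφm n)
  have hTE : T ⁻¹' E = E := preimage_unbounded_birkhoffSum φ
  have h0 : 0 ≤ ∫ ω in E, φ ω ∂μ := by
    refine setIntegral_nonneg_of_unbounded_birkhoffSum hT hφm hφ hE hTE fun ω hω => ?_
    simpa using hω 0
  have hμE : μ E = 0 := by
    have h1 : ∫ ω in E, φ ω ∂μ = -(ε / 2) * μ.real E := by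
      have hgi : Integrable (fun ω => g ω + ε / 2) (μ.restrict E) :=
        (hg.add (integrable_const _)).integrableOn
      simp only [hφdef]
      rw [integral_sub hf.integrableOn hgi,
        integral_add hg.integrableOn (integrable_const _).integrableOn,
        setIntegral_condExp hm hf ⟨hE, hTE⟩]
      simp only [setIntegral_const, smul_eq_mul]
      ring
    have h2 : μ.real E = 0 := by
      have := measureReal_nonneg (μ := μ) (s := E)
      nlinarith
    exact (measureReal_eq_zero_iff).1 h2
  filter_upwards [measure_eq_zero_iff_ae_notMem.1 hμE] with ω hω
  simp only [E, Set.mem_ofPred_eq, not_forall, not_exists, not_lt] at hω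
  obtain ⟨c, hc⟩ := hω
  obtain ⟨N, hN⟩ := exists_nat_gt ((c : ℝ) / (ε / 2))
  filter_upwards [eventually_gt_atTop N] with n hn
  have hn0 : (0 : ℝ) < n := by exact_mod_cast (Nat.zero_le N).trans_lt hn
  have hsum : birkhoffSum T φ n ω = birkhoffSum T f n ω - n * (g ω + ε / 2) := by
    have hit : ∀ i, g (T^[i] ω) = g ω := fun i => by
      induction i with
      | zero => rfl
      | succ i ih => rw [Function.iterate_succ_apply', ← ih]; exact congrFun hgT _
    simp only [birkhoffSum, φ, hit, Finset.sum_sub_distrib, Finset.sum_const, Finset.card_range,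
      nsmul_eq_mul]
  have hcn : (c : ℝ) < n * (ε / 2) := by
    rw [div_lt_iff₀ (by positivity)] at hN
    have : (N : ℝ) < n := by exact_mod_cast hn
    nlinarith
  have := hc n
  rw [birkhoffAverage, smul_eq_mul, inv_mul_lt_iff₀ hn0]
  linarith

/-- **Birkhoff's ergodic theorem**. -/
theorem ae_tendsto_birkhoffAverage [IsProbabilityMeasure μ] (hT : MeasurePreserving T μ μ)
    {f : Ω → ℝ} (hfm : Measurable f) (hf : Integrable f μ) :
    ∀ᵐ ω ∂μ, Tendsto (fun n => birkhoffAverage ℝ T f n ω) atTop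
      (𝓝 ((μ[f | MeasurableSpace.invariants T]) ω)) := by
  have h1 : ∀ᵐ ω ∂μ, ∀ k : ℕ, ∀ᶠ n in atTop, birkhoffAverage ℝ T f n ω
      < (μ[f | MeasurableSpace.invariants T]) ω + 1 / ((k : ℝ) + 1) :=
    ae_all_iff.2 fun k => ae_eventually_birkhoffAverage_lt hT hfm hf (by positivity)
  have h2 : ∀ᵐ ω ∂μ, ∀ k : ℕ, ∀ᶠ n in atTop, birkhoffAverage ℝ T (-f) n ω
      < (μ[-f | MeasurableSpace.invariants T]) ω + 1 / ((k : ℝ) + 1) :=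
    ae_all_iff.2 fun k => ae_eventually_birkhoffAverage_lt hT hfm.neg hf.neg (by positivity)
  filter_upwards [h1, h2, condExp_neg f (MeasurableSpace.invariants T)] with ω h1 h2 h3
  rw [Metric.tendsto_atTop']
  intro ε hε
  obtain ⟨k, hk⟩ := exists_nat_one_div_lt hε
  obtain ⟨N, hN⟩ := eventually_atTop.1 ((h1 k).and (h2 k))
  refine ⟨N, fun n hn => ?_⟩
  obtain ⟨ha, hb⟩ := hN n hn.le
  rw [birkhoffAverage_neg, Pi.neg_apply, Pi.neg_apply, h3, Pi.neg_apply] at hb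
  rw [Real.dist_eq, abs_lt]
  constructor <;> linarith

end Birkhoff

theorem ae_tendsto_zero_of_summable_integral {Ω : Type*} [MeasurableSpace Ω] {μ : Measure Ω}
    {f : ℕ → Ω → ℝ} (hf : ∀ i, Integrable (f i) μ) (h0 : ∀ i ω, 0 ≤ f i ω)
    (hsum : Summable fun i => ∫ ω, f i ω ∂μ) : ∀ᵐ ω ∂μ, Tendsto (fun i => f i ω) atTop (𝓝 0) := by
  have h1 : ∫⁻ ω, ∑' i, ENNReal.ofReal (f i ω) ∂μ ≠ ∞ := by
    rw [lintegral_tsum fun i => (hf i).aestronglyMeasurable.aemeasurable.ennreal_ofReal]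
    simp only [← ofReal_integral_eq_lintegral_ofReal (hf _) (Eventually.of_forall (h0 _))]
    exact hsum.tsum_ofReal_ne_top
  filter_upwards [ae_lt_top' (AEMeasurable.tsum fun i =>
    (hf i).aestronglyMeasurable.aemeasurable.ennreal_ofReal) h1] with ω hω
  have h2 := ENNReal.tendsto_atTop_zero_of_tsum_ne_top hω.ne
  have h3 := (ENNReal.tendsto_toReal ENNReal.zero_ne_top).comp h2
  simpa [Function.comp_def, ENNReal.toReal_ofReal (h0 _ ω)] using h3

/-! ### Ergodic averages along powers of an ergodic map -/

section Powers

variable {Ω : Type*} {T : Ω → Ω}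

/-- Bézout: some multiple of `p` exceeds a multiple of `q` by exactly one. -/
theorem eq_comp_of_coprime_iterates {H : Ω → ℝ} {p q : ℕ} (hpq : p.Coprime q) (hq : 1 < q)
    (hp' : ∀ ω, H (T^[p] ω) = H ω) (hq' : ∀ ω, H (T^[q] ω) = H ω) : H ∘ T = H := by
  have hmul : ∀ r, (∀ ω, H (T^[r] ω) = H ω) → ∀ m ω, H (T^[r * m] ω) = H ω := by
    intro r hr m
    induction m with
    | zero => intro ω; rfl
    | succ m ih =>
      intro ω
      rw [Nat.mul_succ, Function.iterate_add_apply, ih, hr]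
  obtain ⟨m, -, hm⟩ := Nat.exists_mul_mod_eq_one_of_coprime hpq hq
  funext ω
  have h1 : p * m = q * (p * m / q) + 1 := by
    conv_lhs => rw [← Nat.div_add_mod (p * m) q, hm]
  have h2 := hmul p hp' m ω
  rw [h1, Function.iterate_add_apply, hmul q hq'] at h2
  exact h2

variable [MeasurableSpace Ω] {μ : Measure Ω}

/-- Functions invariant under coprime powers of an ergodic map are uncorrelated. -/
theorem integral_mul_of_coprime_iterates [IsProbabilityMeasure μ] (hT : Ergodic T μ)
    {h k : Ω → ℝ} (hk : Measurable k) (hh2 : MemLp h 2 μ) (hk2 : MemLp k 2 μ) {p q : ℕ}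
    (hpq : p.Coprime q) (hq : 1 < q)
    (hp' : ∀ ω, h (T^[p] ω) = h ω) (hq' : ∀ ω, k (T^[q] ω) = k ω) :
    ∫ ω, h ω * k ω ∂μ = (∫ ω, h ω ∂μ) * ∫ ω, k ω ∂μ := by
  have hTp : MeasurePreserving T^[p] μ μ := hT.toMeasurePreserving.iterate p
  -- `H` is invariant under `T^p` (the sum telescopes, as `T^(pq)` fixes `k`) and under `T^q`, hence
  -- under `T`, so it is almost surely constant. Since `h` is `T^p`-invariant, each of the `q`
  -- summands has the same integral against `h`.
  set H := birkhoffSum T^[p] k q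
  have hHm : Measurable H := measurable_birkhoffSum hTp.measurable hk q
  have hH : H ∘ T = H := by
    refine eq_comp_of_coprime_iterates hpq hq (fun ω => ?_) fun ω => ?_
    · have h1 := birkhoffSum_apply_sub_birkhoffSum T^[p] k q ω
      have h2 : k ((T^[p])^[q] ω) = k ω := by
        rw [← Function.iterate_mul, mul_comm, Function.iterate_mul]
        clear h1
        generalize p = r
        induction r with
        | zero => rfl
        | succ r ih => rw [Function.iterate_succ_apply', hq', ih]
      rw [h2, sub_self] at h1
      exact sub_eq_zero.1 h1
    · refine Finset.sum_congr rfl fun i _ => ?_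
      rw [← Function.iterate_mul, ← Function.iterate_add_apply, add_comm,
        Function.iterate_add_apply, hq']
  obtain ⟨c, hc⟩ := hT.toPreErgodic.ae_eq_const_of_ae_eq_comp hHm hH
  have hki : Integrable k μ := hk2.integrable (by norm_num)
  have hmul : Integrable (fun ω => h ω * k ω) μ := hh2.integrable_mul hk2
  have hTi : ∀ i, MeasurePreserving (T^[p])^[i] μ μ := fun i => hTp.iterate i
  have hhi : ∀ i ω, h ((T^[p])^[i] ω) = h ω := by
    intro i
    induction i with
    | zero => intro ω; rfl
    | succ i ih => intro ω; rw [Function.iterate_succ_apply, ih, hp']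
  have hcomp : ∀ (g : Ω → ℝ), Integrable g μ → ∀ i, ∫ ω, g ((T^[p])^[i] ω) ∂μ = ∫ ω, g ω ∂μ := by
    intro g hg i
    have := integral_map (μ := μ) (hTi i).aemeasurable (f := g)
      ((hTi i).map_eq.symm ▸ hg.aestronglyMeasurable)
    rw [(hTi i).map_eq] at this
    exact this.symm
  have hci : ∀ (g : Ω → ℝ), Integrable g μ → ∀ i, Integrable (fun ω => g ((T^[p])^[i] ω)) μ :=
    fun g hg i => (hTi i).integrable_comp_of_integrable hg
  have h1 : ∫ ω, H ω ∂μ = q * ∫ ω, k ω ∂μ := by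
    simp only [H, birkhoffSum]
    rw [integral_finsetSum _ fun i _ => hci k hki i]
    simp [hcomp k hki]
  have h2 : ∫ ω, h ω * H ω ∂μ = q * ∫ ω, h ω * k ω ∂μ := by
    have : ∀ ω, h ω * H ω = ∑ i ∈ Finset.range q, (fun ω => h ω * k ω) ((T^[p])^[i] ω) := by
      intro ω
      simp only [H, birkhoffSum, Finset.mul_sum, hhi]
    rw [integral_congr_ae (Eventually.of_forall this),
      integral_finsetSum _ fun i _ => hci _ hmul i,
      Finset.sum_congr rfl fun i _ => hcomp _ hmul i]
    simp
  have h3 : ∫ ω, H ω ∂μ = c := by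
    rw [integral_congr_ae hc]; simp
  have h4 : ∫ ω, h ω * H ω ∂μ = (∫ ω, h ω ∂μ) * c := by
    rw [← integral_mul_const]
    refine integral_congr_ae ?_
    filter_upwards [hc] with ω hω
    rw [hω]; rfl
  have hq0 : (q : ℝ) ≠ 0 := by positivity
  apply mul_left_cancel₀ hq0
  rw [← h2, h4, ← h3, h1]; ring

/-- Bessel's inequality: subtracting the next `h n` lowers the squared norm of the remainder by
exactly that of `h n`. -/
theorem sum_integral_sq_le_of_orthogonal {g : Ω → ℝ} {h : ℕ → Ω → ℝ} (hg : MemLp g 2 μ)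
    (hh : ∀ i, MemLp (h i) 2 μ) (horth : ∀ i j, i ≠ j → ∫ ω, h i ω * h j ω ∂μ = 0)
    (hgh : ∀ i, ∫ ω, g ω * h i ω ∂μ = ∫ ω, h i ω ^ 2 ∂μ) (n : ℕ) :
    ∑ i ∈ Finset.range n, ∫ ω, h i ω ^ 2 ∂μ ≤ ∫ ω, g ω ^ 2 ∂μ := by
  have hR : ∀ n, MemLp (fun ω => g ω - ∑ i ∈ Finset.range n, h i ω) 2 μ := fun n =>
    hg.sub (memLp_finsetSum _ fun i _ => hh i)
  have key : ∀ n, ∫ ω, (g ω - ∑ i ∈ Finset.range n, h i ω) ^ 2 ∂μ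
      = ∫ ω, g ω ^ 2 ∂μ - ∑ i ∈ Finset.range n, ∫ ω, h i ω ^ 2 ∂μ := by
    intro n
    induction n with
    | zero => simp
    | succ n ih =>
      have h1 : ∫ ω, (g ω - ∑ i ∈ Finset.range n, h i ω) * h n ω ∂μ = ∫ ω, h n ω ^ 2 ∂μ := by
        have hi : ∀ i, Integrable (fun ω => h i ω * h n ω) μ := fun i =>
          (hh i).integrable_mul (hh n)
        have hgi : Integrable (fun ω => g ω * h n ω) μ := hg.integrable_mul (hh n)
        simp only [sub_mul, Finset.sum_mul]
        rw [integral_sub hgi (integrable_finsetSum _ fun i _ => hi i),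
          integral_finsetSum _ fun i _ => hi i, hgh,
          Finset.sum_eq_zero fun i hi => horth i n (Finset.mem_range.1 hi).ne, sub_zero]
      have hn2 : Integrable (fun ω => h n ω ^ 2) μ := (hh n).integrable_sq
      have hRn2 : Integrable (fun ω => (g ω - ∑ i ∈ Finset.range n, h i ω) ^ 2) μ :=
        (hR n).integrable_sq
      have hmul : Integrable (fun ω => (g ω - ∑ i ∈ Finset.range n, h i ω) * h n ω) μ :=
        (hR n).integrable_mul (hh n)
      have h2 : ∀ ω, (g ω - ∑ i ∈ Finset.range (n + 1), h i ω) ^ 2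
          = (g ω - ∑ i ∈ Finset.range n, h i ω) ^ 2
            - 2 * ((g ω - ∑ i ∈ Finset.range n, h i ω) * h n ω) + h n ω ^ 2 := by
        intro ω
        rw [Finset.sum_range_succ]; ring
      simp only [h2]
      have e1 := integral_add (hRn2.sub (hmul.const_mul 2)) hn2
      have e2 := integral_sub hRn2 (hmul.const_mul 2)
      simp only [Pi.sub_apply] at e1
      rw [e1, e2, integral_const_mul, h1, ih, Finset.sum_range_succ]
      ring
  have h0 : 0 ≤ ∫ ω, (g ω - ∑ i ∈ Finset.range n, h i ω) ^ 2 ∂μ :=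
    integral_nonneg fun ω => sq_nonneg _
  linarith [key n]

/-- For an ergodic `T` the limits of the ergodic averages of `f` along `T^p` tend to the mean of
`f` as `p` runs through the primes. -/
theorem ae_tendsto_condExp_invariants_iterate_prime [IsProbabilityMeasure μ] (hT : Ergodic T μ)
    {f : Ω → ℝ} (hf : MemLp f 2 μ) :
    ∀ᵐ ω ∂μ, Tendsto (fun i =>
      (μ[f | MeasurableSpace.invariants T^[Nat.nth Nat.Prime i]]) ω) atTop (𝓝 (∫ ω, f ω ∂μ)) := by
  set c := ∫ ω, f ω ∂μ
  set P := fun i => Nat.nth Nat.Prime i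
  have hP : ∀ i, (P i).Prime := fun i => Nat.prime_nth_prime i
  have hPinj : Function.Injective P := Nat.nth_injective Nat.infinite_setOfPred_prime
  have hle := fun i => MeasurableSpace.invariants_le (T^[P i])
  have hfi : Integrable f μ := hf.integrable (by norm_num)
  -- Distinct primes are coprime, so these centred projections are orthogonal. Bessel's inequality
  -- makes their squared norms summable, which gives almost sure convergence to `0`.
  let h : ℕ → Ω → ℝ := fun i ω => (μ[f | MeasurableSpace.invariants T^[P i]]) ω - c
  have hm' : ∀ i, Measurable[MeasurableSpace.invariants T^[P i]] (h i) := fun i =>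
    stronglyMeasurable_condExp.measurable.sub_const c
  have hinv : ∀ i ω, h i (T^[P i] ω) = h i ω := fun i ω =>
    congrFun (MeasurableSpace.comp_eq_of_measurable_invariants (hm' i)) ω
  have hmem : ∀ i, MemLp (h i) 2 μ := fun i => (hf.condExp one_le_two).sub (memLp_const c)
  have hint : ∀ i, ∫ ω, h i ω ∂μ = 0 := fun i => by
    simp only [h]
    rw [integral_sub integrable_condExp (integrable_const _), integral_condExp (hle i)]
    simp [c]
  have horth : ∀ i j, i ≠ j → ∫ ω, h i ω * h j ω ∂μ = 0 := fun i j hij => by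
    rw [integral_mul_of_coprime_iterates hT ((hm' j).mono (hle j) le_rfl) (hmem i) (hmem j)
      ((Nat.coprime_primes (hP i) (hP j)).2 (hPinj.ne hij)) (hP j).one_lt (hinv i) (hinv j),
      hint, zero_mul]
  have hgh : ∀ i, ∫ ω, (f ω - c) * h i ω ∂μ = ∫ ω, h i ω ^ 2 ∂μ := fun i => by
    have hfh : Integrable (f * h i) μ := hf.integrable_mul (hmem i)
    have h1 : ∫ ω, f ω * h i ω ∂μ
        = ∫ ω, (μ[f | MeasurableSpace.invariants T^[P i]]) ω * h i ω ∂μ := by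
      rw [← integral_condExp (hle i) (f := fun ω => f ω * h i ω)]
      exact integral_congr_ae (condExp_mul_of_stronglyMeasurable_right
        (hm' i).stronglyMeasurable hfh hfi)
    have h2 : Integrable (fun ω => c * h i ω) μ :=
      ((hmem i).integrable (by norm_num)).const_mul c
    have h3 : Integrable (fun ω => (μ[f | MeasurableSpace.invariants T^[P i]]) ω * h i ω) μ :=
      (hf.condExp one_le_two).integrable_mul (hmem i)
    simp only [sub_mul]
    rw [integral_sub (f := fun ω => f ω * h i ω) hfh h2, h1, ← integral_sub h3 h2]
    refine integral_congr_ae (Eventually.of_forall fun ω => ?_)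
    simp only [h]; ring
  have hsum : Summable fun i => ∫ ω, h i ω ^ 2 ∂μ :=
    summable_of_sum_range_le (fun i => integral_nonneg fun ω => sq_nonneg _)
      (sum_integral_sq_le_of_orthogonal (hf.sub (memLp_const c)) hmem horth hgh)
  filter_upwards [ae_tendsto_zero_of_summable_integral (fun i => (hmem i).integrable_sq)
    (fun i ω => sq_nonneg _) hsum] with ω hω
  have h1 : Tendsto (fun i => h i ω) atTop (𝓝 0) := by
    have := hω.sqrt
    simp only [Real.sqrt_sq_eq_abs, Real.sqrt_zero] at this
    exact (tendsto_zero_iff_abs_tendsto_zero _).2 this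
  simpa [h] using h1.add_const c

/-- Almost surely the ergodic averages along some power of `T` are eventually close to the mean. -/
theorem ae_exists_birkhoffAverage_iterate_near [IsProbabilityMeasure μ] (hT : Ergodic T μ)
    {f : Ω → ℝ} (hfm : Measurable f) (hf : MemLp f 2 μ) :
    ∀ᵐ ω ∂μ, ∀ η > 0, ∀ J : ℕ, ∃ p ≥ J, ∀ᶠ N in atTop,
      |birkhoffAverage ℝ T^[p] f N ω - ∫ ω, f ω ∂μ| < η := by
  have h1 : ∀ᵐ ω ∂μ, ∀ p : ℕ, Tendsto (fun N => birkhoffAverage ℝ T^[p] f N ω) atTop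
      (𝓝 ((μ[f | MeasurableSpace.invariants T^[p]]) ω)) :=
    ae_all_iff.2 fun p => ae_tendsto_birkhoffAverage (hT.toMeasurePreserving.iterate p) hfm
      (hf.integrable (by norm_num))
  filter_upwards [h1, ae_tendsto_condExp_invariants_iterate_prime hT hf] with ω h1 h2 η hη J
  obtain ⟨i, hi, hiJ⟩ := ((Metric.tendsto_nhds.1 h2 (η / 2) (half_pos hη)).and
    (eventually_ge_atTop J)).exists
  refine ⟨Nat.nth Nat.Prime i,
    hiJ.trans (Nat.nth_strictMono Nat.infinite_setOfPred_prime).le_apply, ?_⟩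
  filter_upwards [Metric.tendsto_nhds.1 (h1 (Nat.nth Nat.Prime i)) (η / 2) (half_pos hη)]
    with N hN
  rw [Real.dist_eq] at hi hN
  exact (abs_sub_le _ _ _).trans_lt (by linarith)

end Powers

/-! ### Cylinder sets -/

theorem shift_iterate_apply (a : ℕ) (ω : Path) (i : ℕ) : (shift^[a] ω) i = ω (i + a) := by
  induction a generalizing ω with
  | zero => rfl
  | succ a ih => rw [Function.iterate_succ_apply, ih]; rfl

theorem measurable_shift : Measurable shift :=
  measurable_pi_iff.2 fun i => measurable_pi_apply (i + 1)

/-- The index of the dyadic interval of level `ℓ` which contains `x`. -/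
noncomputable def digit (ℓ : ℕ) (x : I) : Fin (2 ^ ℓ) :=
  -- The minimum only matters at `x = 1`, which goes into the last interval.
  ⟨min ⌊(x : ℝ) * 2 ^ ℓ⌋₊ (2 ^ ℓ - 1),
    (min_le_right _ _).trans_lt (Nat.sub_lt (by positivity) one_pos)⟩

theorem mem_dyadicInterval_iff {ℓ : ℕ} {i : Fin (2 ^ ℓ)} {x : I} :
    x ∈ dyadicInterval ℓ i ↔ digit ℓ x = i := by
  have hx0 : (0 : ℝ) ≤ (x : ℝ) * 2 ^ ℓ := mul_nonneg x.2.1 (by positivity)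
  have hp : (0 : ℝ) < 2 ^ ℓ := by positivity
  have hx1 : (x : ℝ) * 2 ^ ℓ ≤ 2 ^ ℓ := mul_le_of_le_one_left hp.le x.2.2
  have hi := i.2
  have hcast : ((2 ^ ℓ : ℕ) : ℝ) = 2 ^ ℓ := by push_cast; rfl
  rw [dyadicInterval, Set.mem_ofPred_eq, Fin.ext_iff, digit, div_le_iff₀ hp, lt_div_iff₀ hp]
  simp only
  have hfl : (i : ℝ) ≤ (x : ℝ) * 2 ^ ℓ ↔ (i : ℕ) ≤ ⌊(x : ℝ) * 2 ^ ℓ⌋₊ :=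
    (Nat.le_floor_iff hx0).symm
  have hfl' : (x : ℝ) * 2 ^ ℓ < (i : ℝ) + 1 ↔ ⌊(x : ℝ) * 2 ^ ℓ⌋₊ < (i : ℕ) + 1 := by
    rw [Nat.floor_lt hx0]; push_cast; rfl
  have hle : ⌊(x : ℝ) * 2 ^ ℓ⌋₊ ≤ 2 ^ ℓ := by
    rw [← hcast] at hx1
    exact_mod_cast (Nat.floor_le_floor hx1).trans_eq (Nat.floor_natCast _)
  have heq : (x : ℝ) = 1 ↔ ⌊(x : ℝ) * 2 ^ ℓ⌋₊ = 2 ^ ℓ := by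
    constructor
    · intro h
      rw [h, one_mul, ← hcast, Nat.floor_natCast]
    · intro h
      have h1 := Nat.floor_le hx0
      rw [h, hcast] at h1
      exact le_antisymm x.2.2 (by nlinarith)
  rw [hfl, hfl', heq]
  omega

/-- Coarsening drops binary digits. Truncation is compatible with it because division by `2 ^ d` is
monotone and sends the last index of the fine level to that of the coarse one. -/
theorem digit_eq_div {ℓ ℓ' : ℕ} (h : ℓ ≤ ℓ') (x : I) :
    (digit ℓ x : ℕ) = (digit ℓ' x : ℕ) / 2 ^ (ℓ' - ℓ) := by
  obtain ⟨d, rfl⟩ := Nat.exists_eq_add_of_le h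
  rw [Nat.add_sub_cancel_left]
  have hd : 0 < 2 ^ d := by positivity
  have h1 : ⌊(x : ℝ) * 2 ^ ℓ⌋₊ = ⌊(x : ℝ) * 2 ^ (ℓ + d)⌋₊ / 2 ^ d := by
    rw [← Nat.floor_div_natCast]
    congr 1
    push_cast
    rw [pow_add]
    field_simp
  have h2 : 2 ^ ℓ - 1 = (2 ^ (ℓ + d) - 1) / 2 ^ d := by
    symm
    have hl : 0 < 2 ^ ℓ := by positivity
    rw [Nat.div_eq_iff hd, pow_add]
    obtain ⟨c, hc⟩ := Nat.exists_eq_succ_of_ne_zero hl.ne'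
    rw [hc]
    simp only [Nat.succ_eq_add_one, Nat.add_sub_cancel, Nat.add_mul, one_mul]
    omega
  have hmono : Monotone fun a : ℕ => a / 2 ^ d := fun a b hab => Nat.div_le_div_right hab
  have h3 := hmono.map_min (a := ⌊(x : ℝ) * 2 ^ (ℓ + d)⌋₊) (b := 2 ^ (ℓ + d) - 1)
  simp only [digit]
  rw [h1, h2, h3]

theorem digit_eq_of_le {ℓ ℓ' : ℕ} (h : ℓ ≤ ℓ') {x y : I} (hxy : digit ℓ' x = digit ℓ' y) :
    digit ℓ x = digit ℓ y := by
  rw [Fin.ext_iff, digit_eq_div h, digit_eq_div h, hxy]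

theorem measurable_digit (ℓ : ℕ) : Measurable (digit ℓ) := by
  refine measurable_to_countable' fun i => ?_
  have h : digit ℓ ⁻¹' {i} = {x : I | (i : ℕ) = min ⌊(x : ℝ) * 2 ^ ℓ⌋₊ (2 ^ ℓ - 1)} := by
    ext x
    simp [digit, Fin.ext_iff, eq_comm]
  rw [h]
  have hm : Measurable fun x : I => min ⌊(x : ℝ) * 2 ^ ℓ⌋₊ (2 ^ ℓ - 1) :=
    (Nat.measurable_floor.comp (measurable_subtype_coe.mul_const _)).min measurable_const
  exact measurableSet_eq_fun measurable_const hm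

theorem abs_sub_digit_le (ℓ : ℕ) (x : I) : |((digit ℓ x : ℕ) : ℝ) / 2 ^ ℓ - x| ≤ (1 / 2) ^ ℓ := by
  have hx := (mem_dyadicInterval_iff (i := digit ℓ x)).2 rfl
  have hp : (0 : ℝ) < 2 ^ ℓ := by positivity
  obtain ⟨h1, h2⟩ := hx
  have h3 : (x : ℝ) ≤ (((digit ℓ x : ℕ) : ℝ) + 1) / 2 ^ ℓ := by
    rcases h2 with h | ⟨h, h'⟩
    · exact h.le
    · have : (((digit ℓ x : ℕ) : ℝ) + 1) = 2 ^ ℓ := by exact_mod_cast h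
      rw [this, div_self hp.ne', h']
  rw [add_div] at h3
  rw [one_div_pow, abs_le]
  constructor <;> linarith [show (0 : ℝ) < 1 / 2 ^ ℓ by positivity]

theorem tendsto_digit_div (x : I) :
    Tendsto (fun ℓ => ((digit ℓ x : ℕ) : ℝ) / 2 ^ ℓ) atTop (𝓝 (x : ℝ)) := by
  rw [tendsto_iff_dist_tendsto_zero]
  refine squeeze_zero (fun _ => dist_nonneg) (fun ℓ => ?_)
    (tendsto_pow_atTop_nhds_zero_of_lt_one (by norm_num : (0 : ℝ) ≤ 1 / 2) (by norm_num))
  rw [Real.dist_eq]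
  exact abs_sub_digit_le ℓ x

/-- The events which are determined by the digits of level `ℓ` of the first `k` coordinates. -/
def IsCyl (k ℓ : ℕ) (E : Set Path) : Prop :=
  ∀ ⦃ω ω' : Path⦄, (∀ r < k, digit ℓ (ω r) = digit ℓ (ω' r)) → ω ∈ E → ω' ∈ E

namespace IsCyl

variable {k k' ℓ ℓ' : ℕ} {E F : Set Path}

theorem mono (hE : IsCyl k ℓ E) (hk : k ≤ k') (hℓ : ℓ ≤ ℓ') : IsCyl k' ℓ' E :=
  fun _ _ h => hE fun r hr => digit_eq_of_le hℓ (h r (hr.trans_le hk))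

theorem univ (k ℓ : ℕ) : IsCyl k ℓ Set.univ := fun _ _ _ _ => trivial

theorem empty (k ℓ : ℕ) : IsCyl k ℓ ∅ := fun _ _ _ h => h.elim

theorem compl (hE : IsCyl k ℓ E) : IsCyl k ℓ Eᶜ :=
  fun _ _ h hω hω' => hω (hE (fun r hr => (h r hr).symm) hω')

theorem inter (hE : IsCyl k ℓ E) (hF : IsCyl k ℓ F) : IsCyl k ℓ (E ∩ F) :=
  fun _ _ h hω => ⟨hE h hω.1, hF h hω.2⟩

theorem union (hE : IsCyl k ℓ E) (hF : IsCyl k ℓ F) : IsCyl k ℓ (E ∪ F) :=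
  fun _ _ h hω => hω.imp (hE h) (hF h)

theorem preimage_shift (hE : IsCyl k ℓ E) (a : ℕ) : IsCyl (a + k) ℓ (shift^[a] ⁻¹' E) := by
  intro ω ω' h hω
  refine hE (fun r hr => ?_) hω
  rw [shift_iterate_apply, shift_iterate_apply]
  exact h (r + a) (by omega)

end IsCyl

theorem block_shift (ω : Path) (a k : ℕ) : block ω a k = block (shift^[a] ω) 0 k := by
  funext r
  simp only [block, shift_iterate_apply]
  congr 1
  omega

theorem block_zero_mem_toSet_iff {ω : Path} {k ℓ : ℕ} {A : CubeSet k ℓ} :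
    block ω 0 k ∈ A.toSet ↔ (fun r : Fin k => digit ℓ (ω r)) ∈ A := by
  simp only [CubeSet.toSet, Set.mem_iUnion, dyadicCube, Set.mem_ofPred_eq, mem_dyadicInterval_iff,
    block, zero_add, exists_prop]
  constructor
  · rintro ⟨i, hi, h⟩
    rwa [show (fun r : Fin k => digit ℓ (ω r)) = i from funext h]
  · exact fun h => ⟨_, h, fun _ => rfl⟩

theorem isCyl_toSet {k ℓ : ℕ} (A : CubeSet k ℓ) : IsCyl k ℓ {ω | block ω 0 k ∈ A.toSet} := by
  intro ω ω' h hω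
  rw [Set.mem_ofPred_eq, block_zero_mem_toSet_iff] at hω ⊢
  rwa [← show (fun r : Fin k => digit ℓ (ω r)) = fun r : Fin k => digit ℓ (ω' r) from
    funext fun r => h r r.2]

/-- Allows the whole argument to use events in path space instead of unions of cubes in varying
dimensions. -/
theorem IsCyl.exists_cubeSet {k ℓ : ℕ} {E : Set Path} (hE : IsCyl k ℓ E) :
    ∃ A : CubeSet k ℓ, ∀ ω, ω ∈ E ↔ block ω 0 k ∈ A.toSet := by
  classical
  refine ⟨Finset.univ.filter fun c => ∃ ω ∈ E, (fun r : Fin k => digit ℓ (ω r)) = c,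
    fun ω => ?_⟩
  rw [block_zero_mem_toSet_iff, Finset.mem_filter]
  constructor
  · exact fun h => ⟨Finset.mem_univ _, ω, h, rfl⟩
  · rintro ⟨-, ω', hω', h⟩
    exact hE (fun r hr => congrFun h ⟨r, hr⟩) hω'

theorem IsCyl.measurableSet_past {k ℓ : ℕ} {E : Set Path} (hE : IsCyl k ℓ E) :
    MeasurableSet[past k] E := by
  obtain ⟨A, hA⟩ := hE.exists_cubeSet
  have h : E = (fun (ω : Path) (r : Fin k) => digit ℓ (ω r)) ⁻¹'
      (A : Set (Fin k → Fin (2 ^ ℓ))) := by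
    ext ω
    rw [hA, block_zero_mem_toSet_iff]
    rfl
  rw [h]
  have hm : Measurable[past k] fun (ω : Path) (r : Fin k) => digit ℓ (ω r) := by
    refine @measurable_pi_lambda _ _ _ (past k) _ _ fun r => (measurable_digit ℓ).comp ?_
    refine Measurable.mono (comap_measurable fun ω : Path => ω r) ?_ le_rfl
    exact le_iSup₂_of_le (r : ℕ) r.2 le_rfl
  exact hm (Finset.measurableSet A)

theorem past_le (j : ℕ) : past j ≤ MeasurableSpace.pi :=
  iSup₂_le fun i _ => (measurable_pi_apply i).comap_le

theorem future_anti {a a' : ℕ} (h : a ≤ a') : future a' ≤ future a :=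
  iSup₂_le fun i hi => le_iSup₂_of_le i (h.trans hi) le_rfl

theorem future_eq_comap (a : ℕ) :
    future (a + 1) = MeasurableSpace.comap shift^[a] MeasurableSpace.pi := by
  apply le_antisymm
  · refine iSup₂_le fun i hi => ?_
    have h : (fun ω : Path => ω i) = (fun ω : Path => ω (i - a)) ∘ shift^[a] := by
      funext ω
      rw [Function.comp_apply, shift_iterate_apply, Nat.sub_add_cancel (by omega)]
    rw [h, ← MeasurableSpace.comap_comp]
    exact MeasurableSpace.comap_mono (measurable_pi_apply _).comap_le
  · rw [← measurable_iff_comap_le]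
    refine @measurable_pi_lambda _ _ _ (future (a + 1)) _ _ fun i => ?_
    simp only [shift_iterate_apply]
    refine Measurable.mono (comap_measurable fun ω : Path => ω (i + a)) ?_ le_rfl
    exact le_iSup₂_of_le (i + a) (by omega) le_rfl

theorem IsCyl.measurableSet {k ℓ : ℕ} {E : Set Path} (hE : IsCyl k ℓ E) : MeasurableSet E :=
  past_le k E hE.measurableSet_past

/-! ### Approximation by cylinder sets -/

/-- The set `K` of lengths covers two cases: a singleton `{j}` for the past, all of `ℕ` for the full
σ-algebra. -/
theorem isSetAlgebra_isCyl {K : Set ℕ} (hK : K.Nonempty) (hdir : DirectedOn (· ≤ ·) K) :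
    IsSetAlgebra {E | ∃ k ∈ K, ∃ ℓ, IsCyl k ℓ E} where
  empty_mem := hK.elim fun k hk => ⟨k, hk, 0, IsCyl.empty k 0⟩
  compl_mem := fun _ ⟨k, hk, ℓ, hs⟩ => ⟨k, hk, ℓ, hs.compl⟩
  union_mem := by
    rintro s t ⟨k, hk, ℓ, hs⟩ ⟨k', hk', ℓ', ht⟩
    obtain ⟨k'', hk'', h, h'⟩ := hdir k hk k' hk'
    exact ⟨k'', hk'', max ℓ ℓ', (hs.mono h (le_max_left _ _)).union (ht.mono h' (le_max_right _ _))⟩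

theorem measurable_eval_generateFrom_isCyl {K : Set ℕ} {k i : ℕ} (hk : k ∈ K) (hi : i < k) :
    Measurable[MeasurableSpace.generateFrom {E | ∃ k ∈ K, ∃ ℓ, IsCyl k ℓ E}]
      fun ω : Path => ω i := by
  set m := MeasurableSpace.generateFrom {E | ∃ k ∈ K, ∃ ℓ, IsCyl k ℓ E} with hm
  have h1 : ∀ ℓ, Measurable[m] fun ω : Path => digit ℓ (ω i) := fun ℓ => by
    refine @measurable_to_countable' _ _ _ _ m _ fun c => ?_
    refine MeasurableSpace.measurableSet_generateFrom ⟨k, hk, ℓ, fun ω ω' h hω => ?_⟩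
    rw [Set.mem_preimage, Set.mem_singleton_iff] at hω ⊢
    rw [← hω, h i hi]
  have h2 : Measurable[m] fun ω : Path => ((ω i : I) : ℝ) := by
    refine @measurable_of_tendsto_metrizable _ _ m _ _ _ _
      (fun ℓ ω => ((digit ℓ (ω i) : ℕ) : ℝ) / 2 ^ ℓ) _ (fun ℓ => ?_)
      (tendsto_pi_nhds.2 fun ω => tendsto_digit_div (ω i))
    exact (measurable_from_top (f := fun c : Fin (2 ^ ℓ) => ((c : ℕ) : ℝ) / 2 ^ ℓ)).comp (h1 ℓ)
  exact h2.subtype_mk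

theorem generateFrom_isCyl_past (j : ℕ) :
    past j = MeasurableSpace.generateFrom {E | ∃ k ∈ ({j} : Set ℕ), ∃ ℓ, IsCyl k ℓ E} := by
  apply le_antisymm
  · exact iSup₂_le fun i hi =>
      (measurable_eval_generateFrom_isCyl (Set.mem_singleton j) hi).comap_le
  · refine MeasurableSpace.generateFrom_le ?_
    rintro E ⟨k, rfl, ℓ, hE⟩
    exact hE.measurableSet_past

theorem generateFrom_isCyl :
    (MeasurableSpace.pi : MeasurableSpace Path)
      = MeasurableSpace.generateFrom {E | ∃ k ∈ (Set.univ : Set ℕ), ∃ ℓ, IsCyl k ℓ E} := by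
  apply le_antisymm
  · exact iSup_le fun i =>
      (measurable_eval_generateFrom_isCyl (Set.mem_univ (i + 1)) i.lt_succ_self).comap_le
  · refine MeasurableSpace.generateFrom_le ?_
    rintro E ⟨k, -, ℓ, hE⟩
    exact hE.measurableSet

theorem exists_symmDiff_lt_of_isSetAlgebra {Ω : Type*} {m m0 : MeasurableSpace Ω} (hm : m ≤ m0)
    {μ : Measure Ω} [IsFiniteMeasure μ] {C : Set (Set Ω)} (hC : IsSetAlgebra C)
    (hgen : m = MeasurableSpace.generateFrom C) {U : Set Ω} (hU : MeasurableSet[m] U) {η : ℝ}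
    (hη : 0 < η) : ∃ E ∈ C, μ.real (symmDiff E U) < η := by
  have hCm : ∀ E ∈ C, MeasurableSet[m] E := fun E hE => by
    rw [hgen]; exact MeasurableSpace.measurableSet_generateFrom hE
  obtain ⟨E, hE, h⟩ := @exists_measure_symmDiff_lt_of_generateFrom_isSetRing _ m (μ.trim hm) _ C
    hC.isSetRing ⟨{Set.univ}, Set.countable_singleton _, by simpa using hC.univ_mem, by simp⟩
    hgen _ hU _ (ENNReal.ofReal_pos.2 hη)
  refine ⟨E, hE, ?_⟩
  rw [trim_measurableSet_eq hm (@MeasurableSet.symmDiff _ m _ _ (hCm E hE) hU)] at h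
  rw [measureReal_def]
  exact (ENNReal.lt_ofReal_iff_toReal_lt (measure_ne_top _ _)).1 h

theorem abs_measureReal_sub_le_symmDiff {Ω : Type*} [MeasurableSpace Ω] (μ : Measure Ω)
    [IsFiniteMeasure μ] (E U : Set Ω) : |μ.real U - μ.real E| ≤ μ.real (symmDiff E U) := by
  have h1 : μ.real U ≤ μ.real E + μ.real (symmDiff E U) :=
    (measureReal_mono (fun x hx => by
      by_cases h : x ∈ E
      · exact Or.inl h
      · exact Or.inr (Or.inr ⟨hx, h⟩))).trans (measureReal_union_le _ _)
  have h2 : μ.real E ≤ μ.real U + μ.real (symmDiff E U) :=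
    (measureReal_mono (fun x hx => by
      by_cases h : x ∈ U
      · exact Or.inl h
      · exact Or.inr (Or.inl ⟨hx, h⟩))).trans (measureReal_union_le _ _)
  rw [abs_le]
  constructor <;> linarith

theorem measureReal_preimage_shift {μ : Measure Path} (hμ : MeasurePreserving shift μ μ) (a : ℕ)
    {E : Set Path} (hE : MeasurableSet E) : μ.real (shift^[a] ⁻¹' E) = μ.real E :=
  (hμ.iterate a).measureReal_preimage hE.nullMeasurableSet

theorem abs_mul_sub_mul_le {x y a b : ℝ} (hx : |x| ≤ 1) (hb : |b| ≤ 1) :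
    |x * y - a * b| ≤ |x - a| + |y - b| := by
  have h : x * y - a * b = x * (y - b) + (x - a) * b := by ring
  rw [h]
  refine (abs_add_le _ _).trans ?_
  rw [abs_mul, abs_mul]
  nlinarith [abs_nonneg (x - a), abs_nonneg (y - b)]

theorem abs_measureReal_le_one {Ω : Type*} [MeasurableSpace Ω] (μ : Measure Ω)
    [IsProbabilityMeasure μ] (E : Set Ω) : |μ.real E| ≤ 1 := by
  rw [abs_of_nonneg measureReal_nonneg]
  exact measureReal_le_one

/-- It suffices to test the mixing coefficients on cylinder sets. -/
theorem alpha_le_of_isCyl {μ : Measure Path} [IsProbabilityMeasure μ]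
    (hμ : MeasurePreserving shift μ μ) {m : ℕ} (hm : 1 ≤ m) {c : ℝ}
    (h : ∀ j k ℓ E F, 1 ≤ j → IsCyl j ℓ E → IsCyl k ℓ F →
      |μ.real (E ∩ shift^[j + m - 1] ⁻¹' F) - μ.real E * μ.real F| ≤ c) :
    alpha μ m ≤ ENNReal.ofReal c := by
  refine iSup₂_le fun j hj => iSup₂_le fun U hU => iSup₂_le fun V hV =>
    ENNReal.ofReal_le_ofReal (le_of_forall_pos_le_add fun η hη => ?_)
  rw [show j + m = (j + m - 1) + 1 by omega, future_eq_comap] at hV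
  obtain ⟨V, hV, rfl⟩ := hV
  obtain ⟨E, ⟨j, rfl, ℓ, hE⟩, hEU⟩ := exists_symmDiff_lt_of_isSetAlgebra (past_le j) (μ := μ)
    (isSetAlgebra_isCyl (Set.singleton_nonempty j) (directedOn_singleton j))
    (generateFrom_isCyl_past j) hU (η := η / 4) (by positivity)
  obtain ⟨F, ⟨k, -, ℓ', hF⟩, hFV⟩ := exists_symmDiff_lt_of_isSetAlgebra le_rfl (μ := μ)
    (isSetAlgebra_isCyl Set.univ_nonempty fun a _ b _ =>
      ⟨max a b, trivial, le_max_left a b, le_max_right a b⟩)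
    generateFrom_isCyl hV (η := η / 4) (by positivity)
  set a := j + m - 1
  have h0 := h j k (max ℓ ℓ') E F hj (hE.mono le_rfl (le_max_left _ _))
    (hF.mono le_rfl (le_max_right _ _))
  have hFm := hF.measurableSet
  have h1 := (abs_measureReal_sub_le_symmDiff μ E U).trans hEU.le
  have h2 := (abs_measureReal_sub_le_symmDiff μ F V).trans hFV.le
  have h3 : |μ.real (U ∩ shift^[a] ⁻¹' V) - μ.real (E ∩ shift^[a] ⁻¹' F)| ≤ η / 2 := by
    refine (abs_measureReal_sub_le_symmDiff μ _ _).trans ?_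
    have hsub : symmDiff (E ∩ shift^[a] ⁻¹' F) (U ∩ shift^[a] ⁻¹' V)
        ⊆ symmDiff E U ∪ shift^[a] ⁻¹' (symmDiff F V) := by
      intro x
      simp only [Set.mem_symmDiff, Set.mem_inter_iff, Set.mem_preimage, Set.mem_union]
      tauto
    have := (measureReal_mono hsub (μ := μ)).trans (measureReal_union_le _ _)
    rw [measureReal_preimage_shift hμ a (hFm.symmDiff hV)] at this
    linarith
  rw [measureReal_preimage_shift hμ a hV]
  have h4 : |μ.real U * μ.real V - μ.real E * μ.real F| ≤ η / 2 :=
    (abs_mul_sub_mul_le (abs_measureReal_le_one μ _) (abs_measureReal_le_one μ _)).trans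
      (by linarith)
  rw [abs_le] at *
  constructor <;> linarith

theorem abs_sub_mul_le_one {Ω : Type*} [MeasurableSpace Ω] (μ : Measure Ω)
    [IsProbabilityMeasure μ] (U V W : Set Ω) : |μ.real U - μ.real V * μ.real W| ≤ 1 := by
  have hU := measureReal_le_one (μ := μ) (s := U)
  have hV := measureReal_le_one (μ := μ) (s := V)
  have hW := measureReal_le_one (μ := μ) (s := W)
  have hU0 := measureReal_nonneg (μ := μ) (s := U)
  have hV0 := measureReal_nonneg (μ := μ) (s := V)
  have hW0 := measureReal_nonneg (μ := μ) (s := W)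
  rw [abs_le]
  constructor <;> nlinarith

theorem alpha_le_one (μ : Measure Path) [IsProbabilityMeasure μ] (m : ℕ) : alpha μ m ≤ 1 := by
  refine iSup₂_le fun j hj => iSup₂_le fun U hU => iSup₂_le fun V hV => ?_
  rw [← ENNReal.ofReal_one]
  exact ENNReal.ofReal_le_ofReal (abs_sub_mul_le_one μ _ _ _)

theorem alpha_ne_top (μ : Measure Path) [IsProbabilityMeasure μ] (m : ℕ) : alpha μ m ≠ ∞ :=
  ((alpha_le_one μ m).trans_lt ENNReal.one_lt_top).ne

theorem abs_sub_mul_le_alpha {μ : Measure Path} [IsProbabilityMeasure μ] {m j : ℕ} (hj : 1 ≤ j)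
    {U V : Set Path} (hU : MeasurableSet[past j] U) (hV : MeasurableSet[future (j + m)] V) :
    |μ.real (U ∩ V) - μ.real U * μ.real V| ≤ (alpha μ m).toReal := by
  rw [← ENNReal.ofReal_le_iff_le_toReal (alpha_ne_top μ m)]
  exact le_iSup₂_of_le j hj (le_iSup₂_of_le U hU (le_iSup₂_of_le V hV le_rfl))

/-! ### Empirical frequencies of cylinder sets -/

/-- The frequency of `E` among the first `N` shifts of `ω` by multiples of `s`. -/
noncomputable def freq (ω : Path) (N s : ℕ) (E : Set Path) : ℝ :=
  birkhoffAverage ℝ shift^[s] (E.indicator fun _ => (1 : ℝ)) N ω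

theorem freq_eq_sum (ω : Path) (N s : ℕ) (E : Set Path) :
    freq ω N s E
      = (1 / (N : ℝ)) * ∑ i ∈ Finset.range N, E.indicator (fun _ => (1 : ℝ)) (shift^[i * s] ω) := by
  simp only [freq, birkhoffAverage, birkhoffSum, smul_eq_mul, one_div, ← Function.iterate_mul,
    mul_comm]

theorem freq_nonneg (ω : Path) (N s : ℕ) (E : Set Path) : 0 ≤ freq ω N s E := by
  rw [freq_eq_sum]
  exact mul_nonneg (by positivity)
    (Finset.sum_nonneg fun _ _ => Set.indicator_nonneg (fun _ _ => zero_le_one) _)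

theorem freq_le_one (ω : Path) (N s : ℕ) (E : Set Path) : freq ω N s E ≤ 1 := by
  rw [freq_eq_sum]
  have h : ∑ i ∈ Finset.range N, E.indicator (fun _ => (1 : ℝ)) (shift^[i * s] ω) ≤ N := by
    refine (Finset.sum_le_card_nsmul _ _ 1 fun i _ =>
      Set.indicator_le_self' (fun _ _ => zero_le_one) _).trans ?_
    simp
  rw [one_div_mul_eq_div]
  exact div_le_one_of_le₀ h (Nat.cast_nonneg N)

theorem abs_freq_le_one (ω : Path) (N s : ℕ) (E : Set Path) : |freq ω N s E| ≤ 1 := by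
  rw [abs_of_nonneg (freq_nonneg ω N s E)]
  exact freq_le_one ω N s E

theorem freq_univ (ω : Path) {N : ℕ} (hN : N ≠ 0) (s : ℕ) : freq ω N s Set.univ = 1 := by
  rw [freq_eq_sum]
  simp [hN]

theorem empMeasure_eq_freq {k : ℕ} {B : Set (Fin k → I)} {E : Set Path}
    (h : ∀ ω, ω ∈ E ↔ block ω 0 k ∈ B) (ω : Path) (N : ℕ) :
    empMeasure ω N B = freq ω N k E := by
  rw [freq_eq_sum, empMeasure]
  congr 1
  refine Finset.sum_congr rfl fun i _ => ?_
  classical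
  simp only [Set.indicator_apply, h, block_shift ω (i * k) k]

theorem empJoint_eq_freq {j j' : ℕ} {A : Set (Fin j → I)} {B : Set (Fin j' → I)} {E F : Set Path}
    (hE : ∀ ω, ω ∈ E ↔ block ω 0 j ∈ A) (hF : ∀ ω, ω ∈ F ↔ block ω 0 j' ∈ B) (ω : Path)
    (N n m : ℕ) :
    empJoint ω N n m A B = freq ω N n (E ∩ shift^[j + m - 1] ⁻¹' F) := by
  rw [freq_eq_sum, empJoint]
  congr 1
  refine Finset.sum_congr rfl fun i _ => ?_
  classical
  simp only [block_shift ω _ j, block_shift ω _ j', Set.indicator_apply, Set.mem_inter_iff,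
    Set.mem_preimage, hE, hF, ← Function.iterate_add_apply, add_comm (j + m - 1)]
  split_ifs <;> simp_all

theorem le_alphaHat (ω : Path) (N : ℕ) {n ℓ m j : ℕ} (hj : 1 ≤ j) (hjn : j ≤ n - m)
    {E F : Set Path} (hE : IsCyl j ℓ E) (hF : IsCyl (n - m - j + 1) ℓ F) :
    |freq ω N n (E ∩ shift^[j + m - 1] ⁻¹' F) - freq ω N j E * freq ω N (n - m - j + 1) F|
      ≤ alphaHat ω N n ℓ m := by
  obtain ⟨A, hA⟩ := hE.exists_cubeSet
  obtain ⟨B, hB⟩ := hF.exists_cubeSet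
  rw [← empJoint_eq_freq hA hB, ← empMeasure_eq_freq hA, ← empMeasure_eq_freq hB,
    ← Real.coe_nnabs, NNReal.coe_le_coe]
  refine le_trans ?_ (Finset.le_sup (Finset.mem_Icc.2 ⟨hj, hjn⟩))
  refine le_trans ?_ (Finset.le_sup (Finset.mem_univ A))
  exact Finset.le_sup (f := fun B => Real.nnabs (empJoint ω N n m A.toSet (CubeSet.toSet B)
    - empMeasure ω N A.toSet * empMeasure ω N (CubeSet.toSet B))) (Finset.mem_univ B)

theorem alphaHat_le (ω : Path) (N : ℕ) {n ℓ m : ℕ} {c : ℝ} (hc : 0 ≤ c)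
    (h : ∀ j E F, 1 ≤ j → j ≤ n - m → IsCyl j ℓ E → IsCyl (n - m - j + 1) ℓ F →
      |freq ω N n (E ∩ shift^[j + m - 1] ⁻¹' F) - freq ω N j E * freq ω N (n - m - j + 1) F| ≤ c) :
    (alphaHat ω N n ℓ m : ℝ) ≤ c := by
  rw [← NNReal.coe_mk c hc, NNReal.coe_le_coe]
  refine Finset.sup_le fun j hj => Finset.sup_le fun A _ => Finset.sup_le fun B _ => ?_
  rw [← NNReal.coe_le_coe, Real.coe_nnabs, NNReal.coe_mk,
    empJoint_eq_freq (fun _ => Iff.rfl) (fun _ => Iff.rfl),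
    empMeasure_eq_freq (fun _ => Iff.rfl), empMeasure_eq_freq (fun _ => Iff.rfl)]
  rw [Finset.mem_Icc] at hj
  exact h j _ _ hj.1 hj.2 (isCyl_toSet A) (isCyl_toSet B)

/-! ### The lower bound -/

/-- Up to equality there are only countably many cylinder events, so one null set serves them all.
-/
theorem ae_exists_freq_near {μ : Measure Path} [IsProbabilityMeasure μ] (hμ : Ergodic shift μ) :
    ∀ᵐ ω ∂μ, ∀ k ℓ E, IsCyl k ℓ E → ∀ η > 0, ∀ J : ℕ, ∃ p ≥ J, ∀ᶠ N in atTop,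
      |freq ω N p E - μ.real E| < η := by
  have h : ∀ᵐ ω ∂μ, ∀ (k ℓ : ℕ) (A : CubeSet k ℓ), ∀ η > 0, ∀ J : ℕ, ∃ p ≥ J, ∀ᶠ N in atTop,
      |freq ω N p {ω | block ω 0 k ∈ A.toSet} - μ.real {ω | block ω 0 k ∈ A.toSet}| < η := by
    refine ae_all_iff.2 fun k => ae_all_iff.2 fun ℓ => ae_all_iff.2 fun A => ?_
    have hA : MeasurableSet {ω | block ω 0 k ∈ A.toSet} := (isCyl_toSet A).measurableSet
    have := ae_exists_birkhoffAverage_iterate_near hμ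
      (f := {ω | block ω 0 k ∈ A.toSet}.indicator fun _ => (1 : ℝ))
      (measurable_const.indicator hA) (memLp_indicator_const 2 hA 1 (Or.inr (measure_ne_top _ _)))
    rw [integral_indicator_const _ hA, smul_eq_mul, mul_one] at this
    exact this
  filter_upwards [h] with ω hω k ℓ E hE
  obtain ⟨A, hA⟩ := hE.exists_cubeSet
  have : E = {ω | block ω 0 k ∈ A.toSet} := Set.ext hA
  rw [this]
  exact hω k ℓ A

theorem exists_alphaHat_le {ω : Path} {N n ℓ M M₀ : ℕ} {K : ℝ} (hM₀ : 1 ≤ M₀) (hM : M₀ ≤ M)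
    (h : ∑ m ∈ Finset.Icc 1 M, (alphaHat ω N n ℓ m : ℝ) ≤ K) :
    ∃ m, 1 ≤ m ∧ m ≤ M₀ ∧ (alphaHat ω N n ℓ m : ℝ) ≤ K / M₀ := by
  have h0 : (0 : ℝ) < M₀ := by exact_mod_cast hM₀
  have h1 : ∑ m ∈ Finset.Icc 1 M₀, (alphaHat ω N n ℓ m : ℝ) ≤ ∑ m ∈ Finset.Icc 1 M₀, K / M₀ := by
    rw [Finset.sum_const, Nat.card_Icc, Nat.add_sub_cancel, nsmul_eq_mul, mul_div_cancel₀ _ h0.ne']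
    exact (Finset.sum_le_sum_of_subset_of_nonneg (Finset.Icc_subset_Icc_right hM)
      fun _ _ _ => NNReal.coe_nonneg _).trans h
  obtain ⟨m, hm, hle⟩ := Finset.exists_le_of_sum_le ⟨1, Finset.mem_Icc.2 ⟨le_rfl, hM₀⟩⟩ h1
  exact ⟨m, (Finset.mem_Icc.1 hm).1, (Finset.mem_Icc.1 hm).2, hle⟩

section LowerBound

variable {μ : Measure Path} {ω : Path} {N n ℓ M : ℕ → ℕ}

/-- Along the times at which the sum of the empirical coefficients is bounded, the empirical
frequencies of cylinder sets converge. -/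
theorem eventually_freq_near
    (hω : ∀ k ℓ E, IsCyl k ℓ E → ∀ η > 0, ∀ J : ℕ, ∃ p ≥ J, ∀ᶠ N in atTop,
      |freq ω N p E - μ.real E| < η)
    (hN : Tendsto N atTop atTop) (hn : Tendsto n atTop atTop) (hℓ : Tendsto ℓ atTop atTop)
    (hM : Tendsto M atTop atTop) (K : ℝ) {η : ℝ} (hη : 0 < η) :
    ∃ M₀, ∀ k ℓ₀ E, IsCyl k ℓ₀ E → ∀ᶠ t in atTop,
      ∑ m ∈ Finset.Icc 1 (M t), (alphaHat ω (N t) (n t) (ℓ t) m : ℝ) ≤ K →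
        |freq ω (N t) (n t) E - μ.real E| ≤ η ∧
        ∀ q, k ≤ q → 1 ≤ q → q + M₀ ≤ n t → |freq ω (N t) q E - μ.real E| ≤ η := by
  obtain ⟨M₁, hM₁⟩ := exists_nat_gt (K / (η / 4))
  have hM₀ : (0 : ℝ) < ((M₁ + 1 : ℕ) : ℝ) := by positivity
  have hK : K / ((M₁ + 1 : ℕ) : ℝ) ≤ η / 4 := by
    rw [div_lt_iff₀ (by positivity)] at hM₁
    rw [div_le_iff₀ hM₀]
    push_cast
    nlinarith
  refine ⟨M₁ + 1, fun k ℓ₀ E hE => ?_⟩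
  obtain ⟨p, hp, hpN⟩ := hω k ℓ₀ E hE (η / 4) (by positivity) (max k 1)
  filter_upwards [hN.eventually hpN, hN.eventually_ge_atTop 1, hℓ.eventually_ge_atTop ℓ₀,
    hM.eventually_ge_atTop (M₁ + 1), hn.eventually_ge_atTop (p + (M₁ + 1))]
    with t h1 h2 h3 h4 h5 hθ
  obtain ⟨m, hm1, hm2, hm3⟩ := exists_alphaHat_le (by omega) h4 hθ
  -- With the whole space as future event, the dependence at the cheap lag `m` is just the
  -- difference of the frequencies along steps `n t` and `q`. The lag may vary with `t`; only its
  -- bound `M₁ + 1` enters.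
  have hcmp : ∀ q, k ≤ q → 1 ≤ q → q + (M₁ + 1) ≤ n t →
      |freq ω (N t) (n t) E - freq ω (N t) q E| ≤ η / 4 := by
    intro q hq1 hq2 hq3
    have := le_alphaHat ω (N t) (n := n t) (ℓ := ℓ t) (m := m) hq2 (by omega)
      (hE.mono hq1 h3) (IsCyl.univ _ _)
    rw [Set.preimage_univ, Set.inter_univ, freq_univ ω (by omega), mul_one] at this
    exact this.trans (hm3.trans hK)
  have hnE : |freq ω (N t) (n t) E - μ.real E| ≤ η / 2 := by
    have := hcmp p ((le_max_left _ _).trans hp) ((le_max_right _ _).trans hp) h5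
    exact (abs_sub_le _ (freq ω (N t) p E) _).trans (by linarith)
  refine ⟨by linarith, fun q hq1 hq2 hq3 => ?_⟩
  have := hcmp q hq1 hq2 hq3
  rw [abs_sub_comm] at this
  exact (abs_sub_le _ (freq ω (N t) (n t) E) _).trans (by linarith)

variable [IsProbabilityMeasure μ]

theorem eventually_dependence_le (hμ : MeasurePreserving shift μ μ)
    (hω : ∀ k ℓ E, IsCyl k ℓ E → ∀ η > 0, ∀ J : ℕ, ∃ p ≥ J, ∀ᶠ N in atTop,
      |freq ω N p E - μ.real E| < η)
    (hN : Tendsto N atTop atTop) (hn : Tendsto n atTop atTop) (hℓ : Tendsto ℓ atTop atTop)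
    (hM : Tendsto M atTop atTop) (K : ℝ) {η : ℝ} (hη : 0 < η) {m j k ℓ₀ : ℕ} (hm : 1 ≤ m)
    (hj : 1 ≤ j) {E F : Set Path} (hE : IsCyl j ℓ₀ E) (hF : IsCyl k ℓ₀ F) :
    ∀ᶠ t in atTop, ∑ m ∈ Finset.Icc 1 (M t), (alphaHat ω (N t) (n t) (ℓ t) m : ℝ) ≤ K →
      |μ.real (E ∩ shift^[j + m - 1] ⁻¹' F) - μ.real E * μ.real F|
        ≤ alphaHat ω (N t) (n t) (ℓ t) m + η := by
  obtain ⟨r, hr⟩ := eventually_freq_near hω hN hn hℓ hM K (η := η / 3) (by positivity)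
  -- The future block has length `n t - m - j + 1`, possibly too close to `n t` for the frequency
  -- estimate. Delaying `E` by `r` lengthens the past block to `r + j` and shortens the future one
  -- enough; stationarity preserves the probabilities.
  have hE' := hE.preimage_shift r
  have hG : IsCyl (r + j + m - 1 + k) ℓ₀
      (shift^[r] ⁻¹' E ∩ shift^[r + j + m - 1] ⁻¹' F) :=
    (hE'.mono (by omega) le_rfl).inter (hF.preimage_shift _)
  have hGE : μ.real (shift^[r] ⁻¹' E ∩ shift^[r + j + m - 1] ⁻¹' F)
      = μ.real (E ∩ shift^[j + m - 1] ⁻¹' F) := by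
    rw [← measureReal_preimage_shift hμ r (hE.measurableSet.inter
      ((measurable_shift.iterate _) hF.measurableSet)), Set.preimage_inter, ← Set.preimage_comp,
      ← Function.iterate_add, show j + m - 1 + r = r + j + m - 1 by omega]
  filter_upwards [hr _ _ _ hE', hr _ _ _ hF, hr _ _ _ hG, hℓ.eventually_ge_atTop ℓ₀,
    hn.eventually_ge_atTop (r + j + m + k + r)] with t h1 h2 h3 h4 h5 hθ
  have e1 := (h1 hθ).2 (r + j) le_rfl (by omega) (by omega)
  have e2 := (h2 hθ).2 (n t - m - (r + j) + 1) (by omega) (by omega) (by omega)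
  have e3 := (h3 hθ).1
  rw [measureReal_preimage_shift hμ r hE.measurableSet] at e1
  rw [hGE] at e3
  have e4 := le_alphaHat ω (N t) (n := n t) (ℓ := ℓ t) (m := m) (j := r + j) (by omega) (by omega)
    (hE'.mono le_rfl h4) (hF.mono (k' := n t - m - (r + j) + 1) (by omega) h4)
  have e5 := abs_mul_sub_mul_le (y := freq ω (N t) (n t - m - (r + j) + 1) F) (a := μ.real E)
    (abs_freq_le_one ω (N t) (r + j) (shift^[r] ⁻¹' E)) (abs_measureReal_le_one μ F)
  have e6 := e5.trans (add_le_add e1 e2)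
  rw [abs_le] at *
  constructor <;> linarith

theorem eventually_alpha_le (hμ : MeasurePreserving shift μ μ)
    (hω : ∀ k ℓ E, IsCyl k ℓ E → ∀ η > 0, ∀ J : ℕ, ∃ p ≥ J, ∀ᶠ N in atTop,
      |freq ω N p E - μ.real E| < η)
    (hN : Tendsto N atTop atTop) (hn : Tendsto n atTop atTop) (hℓ : Tendsto ℓ atTop atTop)
    (hM : Tendsto M atTop atTop) (K : ℝ) {η : ℝ} (hη : 0 < η) {m : ℕ} (hm : 1 ≤ m) :
    ∀ᶠ t in atTop, ∑ m ∈ Finset.Icc 1 (M t), (alphaHat ω (N t) (n t) (ℓ t) m : ℝ) ≤ K →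
      (alpha μ m).toReal ≤ alphaHat ω (N t) (n t) (ℓ t) m + η := by
  have h : ∃ j k ℓ E F, 1 ≤ j ∧ IsCyl j ℓ E ∧ IsCyl k ℓ F ∧ (alpha μ m).toReal - η / 2
      < |μ.real (E ∩ shift^[j + m - 1] ⁻¹' F) - μ.real E * μ.real F| := by
    by_contra! hcon
    -- Testing on empty events shows that the assumed bound is nonnegative, so `ENNReal.ofReal` does
    -- not truncate it.
    have h0 : 0 ≤ (alpha μ m).toReal - η / 2 :=
      (abs_nonneg _).trans (hcon 1 1 1 ∅ ∅ le_rfl (IsCyl.empty _ _) (IsCyl.empty _ _))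
    have h1 := ENNReal.toReal_le_of_le_ofReal h0 (alpha_le_of_isCyl hμ hm hcon)
    linarith
  obtain ⟨j, k, ℓ₀, E, F, hj, hE, hF, hlt⟩ := h
  filter_upwards [eventually_dependence_le hμ hω hN hn hℓ hM K (half_pos hη) hm hj hE hF]
    with t ht hθ
  linarith [ht hθ]

theorem sum_Icc_one_eq_sum_range {β : Type*} [AddCommMonoid β] (f : ℕ → β) (r : ℕ) :
    ∑ m ∈ Finset.Icc 1 r, f m = ∑ m ∈ Finset.range r, f (m + 1) := by
  induction r with
  | zero => simp
  | succ r ih => rw [Finset.sum_Icc_succ_top (by omega), ih, Finset.sum_range_succ]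

/-- The sum of the empirical coefficients is asymptotically at least `‖α‖`. -/
theorem eventually_lt_sum_alphaHat (hμ : MeasurePreserving shift μ μ)
    (hω : ∀ k ℓ E, IsCyl k ℓ E → ∀ η > 0, ∀ J : ℕ, ∃ p ≥ J, ∀ᶠ N in atTop,
      |freq ω N p E - μ.real E| < η)
    (hN : Tendsto N atTop atTop) (hn : Tendsto n atTop atTop) (hℓ : Tendsto ℓ atTop atTop)
    (hM : Tendsto M atTop atTop) {K : ℝ} (hK : ENNReal.ofReal K < alphaNorm μ) :
    ∀ᶠ t in atTop, K < ∑ m ∈ Finset.Icc 1 (M t), (alphaHat ω (N t) (n t) (ℓ t) m : ℝ) := by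
  -- The negation supplies arbitrarily late times at which the empirical sum is at most `K`, which
  -- is exactly the condition under which the empirical coefficients dominate the true ones.
  by_contra hcon
  rw [not_eventually] at hcon
  refine hK.not_ge (ENNReal.tsum_le_of_sum_range_le fun r => ?_)
  rw [← sum_Icc_one_eq_sum_range, ← ENNReal.ofReal_toReal
    (ENNReal.sum_ne_top.2 fun m _ => alpha_ne_top μ m),
    ENNReal.toReal_sum fun m _ => alpha_ne_top μ m]
  refine ENNReal.ofReal_le_ofReal (le_of_forall_pos_le_add fun η hη => ?_)
  have hη' : 0 < η / ((r : ℝ) + 1) := by positivity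
  have hall : ∀ᶠ t in atTop, ∀ m ∈ Finset.Icc 1 r,
      ∑ m ∈ Finset.Icc 1 (M t), (alphaHat ω (N t) (n t) (ℓ t) m : ℝ) ≤ K →
        (alpha μ m).toReal ≤ alphaHat ω (N t) (n t) (ℓ t) m + η / ((r : ℝ) + 1) :=
    (eventually_all_finset _).2 fun m hm =>
      eventually_alpha_le hμ hω hN hn hℓ hM K hη' (Finset.mem_Icc.1 hm).1
  obtain ⟨t, ht, hall, hMt⟩ := (hcon.and_eventually (hall.and (hM.eventually_ge_atTop r))).exists
  rw [not_lt] at ht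
  calc ∑ m ∈ Finset.Icc 1 r, (alpha μ m).toReal
      ≤ ∑ m ∈ Finset.Icc 1 r, ((alphaHat ω (N t) (n t) (ℓ t) m : ℝ) + η / ((r : ℝ) + 1)) :=
        Finset.sum_le_sum fun m hm => hall m hm ht
    _ = ∑ m ∈ Finset.Icc 1 r, (alphaHat ω (N t) (n t) (ℓ t) m : ℝ) + r * (η / ((r : ℝ) + 1)) := by
        rw [Finset.sum_add_distrib, Finset.sum_const, Nat.card_Icc, Nat.add_sub_cancel,
          nsmul_eq_mul]
    _ ≤ K + η := by
        refine add_le_add ((Finset.sum_le_sum_of_subset_of_nonneg (Finset.Icc_subset_Icc_right hMt)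
          fun _ _ _ => NNReal.coe_nonneg _).trans ht) ?_
        rw [mul_div_assoc', div_le_iff₀ (by positivity)]
        nlinarith

end LowerBound

theorem constC_pos {m : ℕ} (hm : 0 < m) (ℓ n : ℕ) : 0 < constC m ℓ n :=
  Nat.mul_pos hm (by positivity)

/-- The lower bound needs only this divergence, no rate. -/
theorem tendsto_kappa {ℓ n M : ℕ → ℕ} {ε δ : ℕ → ℝ} (hM : ∀ t, 0 < M t) (hδ_pos : ∀ t, 0 < δ t)
    (hδ : Summable δ) (hε_pos : ∀ t, 0 < ε t) (hε : Tendsto ε atTop (𝓝 0)) :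
    Tendsto (kappa ℓ n M ε δ) atTop atTop := by
  have h0 : Tendsto (fun t => ε t ^ 2 * δ t) atTop (𝓝[>] 0) := by
    refine tendsto_nhdsWithin_iff.2 ⟨?_, Eventually.of_forall fun t =>
      mul_pos (pow_pos (hε_pos t) 2) (hδ_pos t)⟩
    simpa using (hε.pow 2).mul hδ.tendsto_atTop_zero
  refine tendsto_nat_ceil_atTop.comp (tendsto_atTop_mono (fun t => ?_)
    (tendsto_inv_nhdsGT_zero.comp h0))
  have hp : 0 < ε t ^ 2 * δ t := mul_pos (pow_pos (hε_pos t) 2) (hδ_pos t)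
  rw [Function.comp_apply, inv_eq_one_div]
  refine div_le_div_of_nonneg_right ?_ hp.le
  exact_mod_cast constC_pos (hM t) (ℓ t) (n t)

/-! ### The upper bound -/

/-! ### Variance of frequencies under summable mixing coefficients -/

section Variance

variable {μ : Measure Path} [IsProbabilityMeasure μ]

theorem integral_indicator_sub_mul {Ω : Type*} [MeasurableSpace Ω] {μ : Measure Ω}
    [IsProbabilityMeasure μ] {U V : Set Ω} (hU : MeasurableSet U) (hV : MeasurableSet V) :
    ∫ ω, (U.indicator (fun _ => (1 : ℝ)) ω - μ.real U) * (V.indicator (fun _ => (1 : ℝ)) ω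
      - μ.real V) ∂μ = μ.real (U ∩ V) - μ.real U * μ.real V := by
  have hi : ∀ W, MeasurableSet W → Integrable (W.indicator fun _ => (1 : ℝ)) μ := fun W hW =>
    (integrable_const 1).indicator hW
  have hI : ∀ W, MeasurableSet W → ∫ ω, W.indicator (fun _ => (1 : ℝ)) ω ∂μ = μ.real W :=
    fun W hW => by rw [integral_indicator_const _ hW, smul_eq_mul, mul_one]
  have h : ∀ ω, (U.indicator (fun _ => (1 : ℝ)) ω - μ.real U) * (V.indicator (fun _ => (1 : ℝ)) ω
      - μ.real V) = (U ∩ V).indicator (fun _ => (1 : ℝ)) ω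
        - μ.real V * U.indicator (fun _ => (1 : ℝ)) ω
        - (μ.real U * V.indicator (fun _ => (1 : ℝ)) ω - μ.real U * μ.real V) := by
    intro ω
    classical
    by_cases h1 : ω ∈ U <;> by_cases h2 : ω ∈ V <;> simp [h1, h2] <;> ring
  have hU' : Integrable (fun ω => μ.real V * U.indicator (fun _ => (1 : ℝ)) ω) μ :=
    (hi U hU).const_mul _
  have hV' : Integrable (fun ω => μ.real U * V.indicator (fun _ => (1 : ℝ)) ω) μ :=
    (hi V hV).const_mul _
  have h1 : Integrable (fun ω => (U ∩ V).indicator (fun _ => (1 : ℝ)) ω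
      - μ.real V * U.indicator (fun _ => (1 : ℝ)) ω) μ := (hi _ (hU.inter hV)).sub hU'
  have h2 : Integrable (fun ω => μ.real U * V.indicator (fun _ => (1 : ℝ)) ω
      - μ.real U * μ.real V) μ := hV'.sub (integrable_const _)
  rw [integral_congr_ae (Eventually.of_forall h), integral_sub h1 h2,
    integral_sub (hi _ (hU.inter hV)) hU', integral_sub hV' (integrable_const _),
    integral_const_mul, integral_const_mul, hI _ (hU.inter hV), hI _ hU, hI _ hV]
  simp
  ring

theorem integral_sq_sum_range_le {Ω : Type*} [MeasurableSpace Ω] {μ : Measure Ω}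
    {X : ℕ → Ω → ℝ} (hX : ∀ i, MemLp (X i) 2 μ) {a : ℕ → ℝ} (ha : ∀ i, 0 ≤ a i)
    (hsum : Summable a) (hvar : ∀ i, ∫ ω, X i ω * X i ω ∂μ ≤ 1)
    (hcov : ∀ i d, ∫ ω, X i ω * X (i + d + 1) ω ∂μ ≤ a d) (N : ℕ) :
    ∫ ω, (∑ i ∈ Finset.range N, X i ω) ^ 2 ∂μ ≤ N * (1 + 2 * ∑' d, a d) := by
  induction N with
  | zero => simp
  | succ N ih =>
    have hS : MemLp (fun ω => ∑ i ∈ Finset.range N, X i ω) 2 μ := memLp_finsetSum _ fun i _ => hX i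
    have hmul : ∀ i, Integrable (fun ω => X i ω * X N ω) μ := fun i =>
      (hX i).integrable_mul (hX N)
    have h1 : ∀ ω, (∑ i ∈ Finset.range (N + 1), X i ω) ^ 2
        = (∑ i ∈ Finset.range N, X i ω) ^ 2 + (2 * ∑ i ∈ Finset.range N, X i ω * X N ω
          + X N ω * X N ω) := by
      intro ω
      rw [Finset.sum_range_succ, ← Finset.sum_mul]
      ring
    have hint : Integrable (fun ω => 2 * ∑ i ∈ Finset.range N, X i ω * X N ω) μ :=
      (integrable_finsetSum _ fun i _ => hmul i).const_mul 2
    have hcross : ∑ i ∈ Finset.range N, ∫ ω, X i ω * X N ω ∂μ ≤ ∑' d, a d := by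
      -- Reindexes the cross terms by the distance `d = N - 1 - i`, so that `a d` bounds each of
      -- them.
      rw [← Finset.sum_range_reflect]
      refine (Finset.sum_le_sum fun d hd => ?_).trans
        (hsum.sum_le_tsum (Finset.range N) fun i _ => ha i)
      have := hcov (N - 1 - d) d
      rw [Finset.mem_range] at hd
      rwa [show N - 1 - d + d + 1 = N by omega] at this
    have hint' : Integrable (fun ω => 2 * ∑ i ∈ Finset.range N, X i ω * X N ω
        + X N ω * X N ω) μ := hint.add (hmul N)
    rw [integral_congr_ae (Eventually.of_forall h1), integral_add hS.integrable_sq hint',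
      integral_add hint (hmul N),
      integral_const_mul, integral_finsetSum _ fun i _ => hmul i]
    push_cast
    linarith [hvar N]

/-- The variance of the frequency of a cylinder set. -/
theorem integral_sq_freq_sub_le (hμ : MeasurePreserving shift μ μ) (hα : alphaNorm μ ≠ ∞)
    {k ℓ : ℕ} (hk : 1 ≤ k) {E : Set Path} (hE : IsCyl k ℓ E) {N : ℕ} (hN : 0 < N) :
    ∫ ω, (freq ω N k E - μ.real E) ^ 2 ∂μ ≤ (1 + 2 * (alphaNorm μ).toReal) / N := by
  have hEm := hE.measurableSet
  set V : ℕ → Set Path := fun i => shift^[i * k] ⁻¹' E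
  have hV : ∀ i, MeasurableSet (V i) := fun i => (measurable_shift.iterate _) hEm
  have hVE : ∀ i, μ.real (V i) = μ.real E := fun i => measureReal_preimage_shift hμ _ hEm
  set X : ℕ → Path → ℝ := fun i ω => (V i).indicator (fun _ => (1 : ℝ)) ω - μ.real (V i)
  have hX : ∀ i, MemLp (X i) 2 μ := fun i =>
    (memLp_indicator_const 2 (hV i) 1 (Or.inr (measure_ne_top _ _))).sub (memLp_const _)
  have hvar : ∀ i, ∫ ω, X i ω * X i ω ∂μ ≤ 1 := fun i => by
    rw [integral_indicator_sub_mul (hV i) (hV i)]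
    exact (le_abs_self _).trans (abs_sub_mul_le_one μ _ _ _)
  have hcov : ∀ i d, ∫ ω, X i ω * X (i + d + 1) ω ∂μ ≤ (alpha μ (d + 1)).toReal := fun i d => by
    rw [integral_indicator_sub_mul (hV i) (hV _)]
    refine (le_abs_self _).trans (abs_sub_mul_le_alpha (j := i * k + k) (by omega)
      (hE.preimage_shift _).measurableSet_past ?_)
    -- The earlier block ends at time `(i + 1) k`, the later one starts at `(i + d + 1) k + 1`: the
    -- lag is `d k + 1 ≥ d + 1`.
    have hle : i * k + k + (d + 1) ≤ (i + d + 1) * k + 1 := by nlinarith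
    refine future_anti hle _ ?_
    rw [future_eq_comap]
    exact ⟨E, hEm, rfl⟩
  have hsum : Summable fun d => (alpha μ (d + 1)).toReal := ENNReal.summable_toReal hα
  have htsum : ∑' d, (alpha μ (d + 1)).toReal = (alphaNorm μ).toReal :=
    (ENNReal.tsum_toReal_eq fun d => alpha_ne_top μ _).symm
  have hN0 : (0 : ℝ) < N := by exact_mod_cast hN
  have hfreq : ∀ ω, (freq ω N k E - μ.real E) ^ 2
      = (1 / (N : ℝ) ^ 2) * (∑ i ∈ Finset.range N, X i ω) ^ 2 := by
    intro ω
    have h1 : ∑ i ∈ Finset.range N, X i ω = N * (freq ω N k E - μ.real E) := by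
      rw [freq_eq_sum]
      simp only [X, hVE, Finset.sum_sub_distrib, Finset.sum_const, Finset.card_range,
        nsmul_eq_mul]
      rw [mul_sub, ← mul_assoc, mul_one_div_cancel hN0.ne', one_mul]
      rfl
    rw [h1]
    field_simp
  rw [integral_congr_ae (Eventually.of_forall hfreq), integral_const_mul]
  have h2 := integral_sq_sum_range_le hX (fun d => ENNReal.toReal_nonneg) hsum hvar hcov N
  rw [htsum] at h2
  calc 1 / (N : ℝ) ^ 2 * ∫ ω, (∑ i ∈ Finset.range N, X i ω) ^ 2 ∂μ
      ≤ 1 / (N : ℝ) ^ 2 * (N * (1 + 2 * (alphaNorm μ).toReal)) :=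
        mul_le_mul_of_nonneg_left h2 (by positivity)
    _ = (1 + 2 * (alphaNorm μ).toReal) / N := by field_simp

end Variance

/-- The event that the first `k` coordinates have the digits `c` of level `ℓ`. -/
def cubeEvent (k ℓ : ℕ) (c : Fin k → Fin (2 ^ ℓ)) : Set Path :=
  {ω | (fun r : Fin k => digit ℓ (ω r)) = c}

theorem isCyl_cubeEvent (k ℓ : ℕ) (c : Fin k → Fin (2 ^ ℓ)) : IsCyl k ℓ (cubeEvent k ℓ c) :=
  fun _ _ h hω => (funext fun r : Fin k => (h r r.2).symm).trans hω

theorem IsCyl.exists_indicator_eq_sum {k ℓ : ℕ} {E : Set Path} (hE : IsCyl k ℓ E) :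
    ∃ A : CubeSet k ℓ, ∀ ω, E.indicator (fun _ => (1 : ℝ)) ω
      = ∑ c ∈ A, (cubeEvent k ℓ c).indicator (fun _ => (1 : ℝ)) ω := by
  classical
  obtain ⟨A, hA⟩ := hE.exists_cubeSet
  refine ⟨A, fun ω => ?_⟩
  simp [Set.indicator_apply, hA, block_zero_mem_toSet_iff, cubeEvent]

/-- A weighted sum of the squared errors of the frequencies of all cubes of level `ℓ` in
dimensions `1, …, n`. -/
noncomputable def sqDev (μ : Measure Path) (N n ℓ : ℕ) (ω : Path) : ℝ :=
  ∑ k ∈ Finset.Icc 1 n, ∑ c : Fin k → Fin (2 ^ ℓ),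
    (2 ^ (k * ℓ) : ℝ) * (freq ω N k (cubeEvent k ℓ c) - μ.real (cubeEvent k ℓ c)) ^ 2

theorem sqDev_nonneg (μ : Measure Path) (N n ℓ : ℕ) (ω : Path) : 0 ≤ sqDev μ N n ℓ ω :=
  Finset.sum_nonneg fun _ _ => Finset.sum_nonneg fun _ _ =>
    mul_nonneg (by positivity) (sq_nonneg _)

theorem card_cubes (k ℓ : ℕ) : Fintype.card (Fin k → Fin (2 ^ ℓ)) = 2 ^ (k * ℓ) := by
  rw [Fintype.card_fun, Fintype.card_fin, Fintype.card_fin, ← pow_mul, mul_comm]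

/-- Cauchy–Schwarz over the at most `2 ^ (k * ℓ)` cubes making up `E`; their number is the weight in
`sqDev`. -/
theorem abs_freq_sub_le_sqrt_sqDev {μ : Measure Path} [IsProbabilityMeasure μ] {k ℓ n : ℕ}
    (hk : 1 ≤ k) (hkn : k ≤ n) {E : Set Path} (hE : IsCyl k ℓ E) (N : ℕ) (ω : Path) :
    |freq ω N k E - μ.real E| ≤ √(sqDev μ N n ℓ ω) := by
  obtain ⟨A, hA⟩ := hE.exists_indicator_eq_sum
  have hf : freq ω N k E = ∑ c ∈ A, freq ω N k (cubeEvent k ℓ c) := by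
    simp only [freq_eq_sum, hA]
    rw [Finset.sum_comm, Finset.mul_sum]
  have hI : ∀ W, MeasurableSet W → ∫ ω, W.indicator (fun _ => (1 : ℝ)) ω ∂μ = μ.real W :=
    fun W hW => by rw [integral_indicator_const _ hW, smul_eq_mul, mul_one]
  have hμ : μ.real E = ∑ c ∈ A, μ.real (cubeEvent k ℓ c) := by
    rw [← hI E hE.measurableSet, integral_congr_ae (Eventually.of_forall hA),
      integral_finsetSum _ fun c _ =>
        (integrable_const (1 : ℝ)).indicator (isCyl_cubeEvent k ℓ c).measurableSet]
    exact Finset.sum_congr rfl fun c _ => hI _ (isCyl_cubeEvent k ℓ c).measurableSet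
  rw [hf, hμ, ← Finset.sum_sub_distrib]
  refine Real.abs_le_sqrt (sq_sum_le_card_mul_sum_sq.trans ?_)
  have hcard : (A.card : ℝ) ≤ 2 ^ (k * ℓ) := by
    have := Finset.card_le_univ A
    rw [card_cubes] at this
    exact_mod_cast this
  calc (A.card : ℝ) * ∑ c ∈ A, (freq ω N k (cubeEvent k ℓ c) - μ.real (cubeEvent k ℓ c)) ^ 2
      ≤ 2 ^ (k * ℓ) * ∑ c, (freq ω N k (cubeEvent k ℓ c) - μ.real (cubeEvent k ℓ c)) ^ 2 :=
        mul_le_mul hcard (Finset.sum_le_sum_of_subset_of_nonneg (Finset.subset_univ A)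
          fun _ _ _ => sq_nonneg _) (Finset.sum_nonneg fun _ _ => sq_nonneg _) (by positivity)
    _ = ∑ c, (2 ^ (k * ℓ) : ℝ)
          * (freq ω N k (cubeEvent k ℓ c) - μ.real (cubeEvent k ℓ c)) ^ 2 := Finset.mul_sum _ _ _
    _ ≤ sqDev μ N n ℓ ω :=
        Finset.single_le_sum (f := fun k => ∑ c : Fin k → Fin (2 ^ ℓ), (2 ^ (k * ℓ) : ℝ)
            * (freq ω N k (cubeEvent k ℓ c) - μ.real (cubeEvent k ℓ c)) ^ 2)
          (fun _ _ => Finset.sum_nonneg fun _ _ => mul_nonneg (by positivity) (sq_nonneg _))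
          (Finset.mem_Icc.2 ⟨hk, hkn⟩)

theorem integrable_sq_freq_sub (μ : Measure Path) [IsProbabilityMeasure μ] (N s : ℕ)
    {E : Set Path} (hE : MeasurableSet E) :
    Integrable (fun ω => (freq ω N s E - μ.real E) ^ 2) μ := by
  have hm : Measurable fun ω => freq ω N s E :=
    (measurable_birkhoffSum (measurable_shift.iterate s)
      (measurable_const.indicator hE) N).const_smul (N : ℝ)⁻¹
  refine MemLp.integrable_sq (MemLp.of_bound (hm.sub_const _).aestronglyMeasurable 2
    (Eventually.of_forall fun ω => ?_))
  rw [Real.norm_eq_abs]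
  refine (abs_sub _ _).trans ?_
  linarith [abs_freq_le_one ω N s E, abs_measureReal_le_one μ E]

theorem integrable_sqDev (μ : Measure Path) [IsProbabilityMeasure μ] (N n ℓ : ℕ) :
    Integrable (sqDev μ N n ℓ) μ :=
  integrable_finsetSum _ fun k _ => integrable_finsetSum _ fun c _ =>
    (integrable_sq_freq_sub μ N k (isCyl_cubeEvent k ℓ c).measurableSet).const_mul _

theorem integral_sqDev_le {μ : Measure Path} [IsProbabilityMeasure μ]
    (hμ : MeasurePreserving shift μ μ) (hα : alphaNorm μ ≠ ∞) {N : ℕ} (hN : 0 < N) (n ℓ : ℕ) :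
    ∫ ω, sqDev μ N n ℓ ω ∂μ
      ≤ n * (2 ^ (n * ℓ)) ^ 2 * ((1 + 2 * (alphaNorm μ).toReal) / N) := by
  have hD : 0 ≤ (1 + 2 * (alphaNorm μ).toReal) / N := by positivity
  have hint : ∀ k (c : Fin k → Fin (2 ^ ℓ)), Integrable (fun ω => (2 ^ (k * ℓ) : ℝ)
      * (freq ω N k (cubeEvent k ℓ c) - μ.real (cubeEvent k ℓ c)) ^ 2) μ := fun k c =>
    (integrable_sq_freq_sub μ N k (isCyl_cubeEvent k ℓ c).measurableSet).const_mul _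
  simp only [sqDev]
  rw [integral_finsetSum _ fun k _ => integrable_finsetSum _ fun c _ => hint k c]
  refine (Finset.sum_le_card_nsmul _ _ ((2 ^ (n * ℓ)) ^ 2
    * ((1 + 2 * (alphaNorm μ).toReal) / N)) fun k hk => ?_).trans_eq ?_
  · rw [Finset.mem_Icc] at hk
    rw [integral_finsetSum _ fun c _ => hint k c]
    refine (Finset.sum_le_card_nsmul _ _ (2 ^ (k * ℓ)
      * ((1 + 2 * (alphaNorm μ).toReal) / N)) fun c _ => ?_).trans ?_
    · rw [integral_const_mul]
      exact mul_le_mul_of_nonneg_left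
        (integral_sq_freq_sub_le hμ hα hk.1 (isCyl_cubeEvent k ℓ c) hN) (by positivity)
    · rw [Finset.card_univ, card_cubes, nsmul_eq_mul]
      push_cast
      rw [← mul_assoc, ← sq]
      have : (2 : ℝ) ^ (k * ℓ) ≤ 2 ^ (n * ℓ) :=
        pow_le_pow_right₀ one_le_two (Nat.mul_le_mul_right ℓ hk.2)
      gcongr
  · rw [Nat.card_Icc, Nat.add_sub_cancel, nsmul_eq_mul, mul_assoc]

/-- Three frequencies are replaced by probabilities, each at cost `√sqDev`. The joint event is a
cylinder of length exactly `n`. -/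
theorem alphaHat_le_alpha_add {μ : Measure Path} [IsProbabilityMeasure μ]
    (hμ : MeasurePreserving shift μ μ) (ω : Path) (N n ℓ : ℕ) {m : ℕ} (hm : 1 ≤ m) :
    (alphaHat ω N n ℓ m : ℝ) ≤ (alpha μ m).toReal + 3 * √(sqDev μ N n ℓ ω) := by
  refine alphaHat_le ω N (by positivity) fun j E F hj hjn hE hF => ?_
  have hG : IsCyl n ℓ (E ∩ shift^[j + m - 1] ⁻¹' F) :=
    (hE.mono (by omega) le_rfl).inter ((hF.preimage_shift _).mono (by omega) le_rfl)
  have h1 := abs_freq_sub_le_sqrt_sqDev (μ := μ) (by omega) le_rfl hG N ω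
  have h2 := abs_freq_sub_le_sqrt_sqDev (μ := μ) hj (by omega : j ≤ n) hE N ω
  have h3 := abs_freq_sub_le_sqrt_sqDev (μ := μ) (by omega) (by omega : n - m - j + 1 ≤ n) hF N ω
  have h4 := (abs_mul_sub_mul_le (y := freq ω N (n - m - j + 1) F) (a := μ.real E)
    (abs_freq_le_one ω N j E) (abs_measureReal_le_one μ F)).trans (add_le_add h2 h3)
  have h5 : |μ.real (E ∩ shift^[j + m - 1] ⁻¹' F) - μ.real E * μ.real F|
      ≤ (alpha μ m).toReal := by
    have := abs_sub_mul_le_alpha (μ := μ) (m := m) hj hE.measurableSet_past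
      (V := shift^[j + m - 1] ⁻¹' F) (by
        rw [show j + m = (j + m - 1) + 1 by omega, future_eq_comap]
        exact ⟨F, hF.measurableSet, rfl⟩)
    rwa [measureReal_preimage_shift hμ _ hF.measurableSet] at this
  rw [abs_le] at *
  constructor <;> linarith

theorem sum_alphaHat_le {μ : Measure Path} [IsProbabilityMeasure μ]
    (hμ : MeasurePreserving shift μ μ) (hα : alphaNorm μ ≠ ∞) (ω : Path) (N n ℓ M : ℕ) :
    ∑ m ∈ Finset.Icc 1 M, (alphaHat ω N n ℓ m : ℝ)
      ≤ (alphaNorm μ).toReal + 3 * (M * √(sqDev μ N n ℓ ω)) := by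
  refine (Finset.sum_le_sum fun m hm =>
    alphaHat_le_alpha_add hμ ω N n ℓ (Finset.mem_Icc.1 hm).1).trans ?_
  rw [Finset.sum_add_distrib, Finset.sum_const, Nat.card_Icc, Nat.add_sub_cancel, nsmul_eq_mul,
    sum_Icc_one_eq_sum_range]
  have h : ∑ i ∈ Finset.range M, (alpha μ (i + 1)).toReal ≤ (alphaNorm μ).toReal := by
    rw [alphaNorm, ENNReal.tsum_toReal_eq fun d => alpha_ne_top μ _]
    exact (ENNReal.summable_toReal hα).sum_le_tsum _ fun _ _ => ENNReal.toReal_nonneg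
  linarith

theorem cube_le_four_mul_two_pow (y : ℕ) : y ^ 3 ≤ 4 * 2 ^ y := by
  rcases lt_or_ge y 4 with h | h
  · interval_cases y <;> norm_num
  · induction y, h using Nat.le_induction with
    | base => norm_num
    | succ y hy ih =>
      have : (y + 1) ^ 3 ≤ 2 * y ^ 3 := by nlinarith [mul_le_mul hy hy (by omega) (by omega)]
      rw [pow_succ 2 y]
      omega

/-- The left side is what the variance bound requires; `constC` is far larger. The cube of `y = 2 ^
(n * ℓ)` is absorbed by `2 ^ y`, and the second factor `m` by the other double exponential. -/
theorem sq_mul_le_four_mul_constC (m : ℕ) {ℓ : ℕ} (hℓ : 0 < ℓ) (n : ℕ) :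
    m ^ 2 * (n * (2 ^ (n * ℓ)) ^ 2) ≤ 4 * constC m ℓ n := by
  have hn : n ≤ 2 ^ (n * ℓ) :=
    n.lt_two_pow_self.le.trans (Nat.pow_le_pow_right two_pos (Nat.le_mul_of_pos_right n hℓ))
  have hm : m ≤ 2 ^ (2 ^ (m * ℓ + 1) + 1) := by
    refine m.lt_two_pow_self.le.trans (Nat.pow_le_pow_right two_pos ?_)
    have h1 := (m * ℓ + 1).lt_two_pow_self
    have h2 := Nat.le_mul_of_pos_right m hℓ
    omega
  have hy := cube_le_four_mul_two_pow (2 ^ (n * ℓ))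
  calc m ^ 2 * (n * (2 ^ (n * ℓ)) ^ 2)
      = m * (m * (n * (2 ^ (n * ℓ)) ^ 2)) := by ring
    _ ≤ m * (2 ^ (2 ^ (m * ℓ + 1) + 1) * (2 ^ (n * ℓ) * (2 ^ (n * ℓ)) ^ 2)) := by gcongr
    _ = m * (2 ^ (2 ^ (m * ℓ + 1) + 1) * (2 ^ (n * ℓ)) ^ 3) := by ring
    _ ≤ m * (2 ^ (2 ^ (m * ℓ + 1) + 1) * (4 * 2 ^ (2 ^ (n * ℓ)))) := by gcongr
    _ = 4 * constC m ℓ n := by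
      rw [constC, add_assoc (2 ^ (n * ℓ)), pow_add 2 (2 ^ (n * ℓ))]
      ring

section Parameters

variable {μ : Measure Path} [IsProbabilityMeasure μ] {ℓ n M : ℕ → ℕ} {ε δ : ℕ → ℝ}

/-- The squares have expectation at most a constant times `ε t ^ 2 * δ t`. Since `ε` is bounded,
summability comes from `δ` alone. -/
theorem ae_tendsto_sqDev (hμ : MeasurePreserving shift μ μ) (hα : alphaNorm μ ≠ ∞)
    (hℓ_pos : ∀ t, 0 < ℓ t) (hM_pos : ∀ t, 0 < M t)
    (hδ_pos : ∀ t, 0 < δ t) (hδ : Summable δ) (hε_pos : ∀ t, 0 < ε t)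
    (hε : Tendsto ε atTop (𝓝 0)) :
    ∀ᵐ ω ∂μ, Tendsto (fun t => M t * √(sqDev μ (kappa ℓ n M ε δ t) (n t) (ℓ t) ω))
      atTop (𝓝 0) := by
  obtain ⟨B, hB⟩ := hε.bddAbove_range
  have hB : ∀ t, ε t ≤ B := fun t => hB ⟨t, rfl⟩
  set D := 1 + 2 * (alphaNorm μ).toReal with hDdef
  have hD : 0 ≤ D := by positivity
  have hbound : ∀ t, ∫ ω, (M t : ℝ) ^ 2 * sqDev μ (kappa ℓ n M ε δ t) (n t) (ℓ t) ω ∂μ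
      ≤ 4 * D * B ^ 2 * δ t := fun t => by
    have hC : (0 : ℝ) < constC (M t) (ℓ t) (n t) := by
      exact_mod_cast constC_pos (hM_pos t) (ℓ t) (n t)
    have hεδ : 0 < ε t ^ 2 * δ t := mul_pos (pow_pos (hε_pos t) 2) (hδ_pos t)
    have hκ : (constC (M t) (ℓ t) (n t) : ℝ) / (ε t ^ 2 * δ t) ≤ kappa ℓ n M ε δ t :=
      Nat.le_ceil _
    have hκ0 : (0 : ℝ) < kappa ℓ n M ε δ t := (div_pos hC hεδ).trans_le hκ
    have hnum : (M t : ℝ) ^ 2 * (n t * (2 ^ (n t * ℓ t)) ^ 2)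
        ≤ 4 * constC (M t) (ℓ t) (n t) := by
      exact_mod_cast sq_mul_le_four_mul_constC (M t) (hℓ_pos t) (n t)
    rw [div_le_iff₀ hεδ] at hκ
    rw [integral_const_mul]
    calc (M t : ℝ) ^ 2 * ∫ ω, sqDev μ (kappa ℓ n M ε δ t) (n t) (ℓ t) ω ∂μ
        ≤ (M t : ℝ) ^ 2 * (n t * (2 ^ (n t * ℓ t)) ^ 2 * (D / kappa ℓ n M ε δ t)) :=
          mul_le_mul_of_nonneg_left
            (integral_sqDev_le hμ hα (by exact_mod_cast hκ0) (n t) (ℓ t)) (by positivity)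
      _ = (M t : ℝ) ^ 2 * (n t * (2 ^ (n t * ℓ t)) ^ 2) * (D / kappa ℓ n M ε δ t) := by ring
      _ ≤ 4 * (kappa ℓ n M ε δ t * (ε t ^ 2 * δ t)) * (D / kappa ℓ n M ε δ t) :=
          mul_le_mul_of_nonneg_right (by linarith) (by positivity)
      _ = 4 * D * ε t ^ 2 * δ t := by field_simp
      _ ≤ 4 * D * B ^ 2 * δ t := by
          have := hε_pos t
          have := hδ_pos t
          have := hB t
          gcongr
  have hnn : ∀ t ω, 0 ≤ (M t : ℝ) ^ 2 * sqDev μ (kappa ℓ n M ε δ t) (n t) (ℓ t) ω :=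
    fun t ω => mul_nonneg (by positivity) (sqDev_nonneg _ _ _ _ _)
  have hsum := Summable.of_nonneg_of_le (fun t => integral_nonneg (hnn t)) hbound
    (hδ.mul_left (4 * D * B ^ 2))
  filter_upwards [ae_tendsto_zero_of_summable_integral
    (fun t => (integrable_sqDev μ _ (n t) (ℓ t)).const_mul _) hnn hsum] with ω hω
  have := hω.sqrt
  simpa [Real.sqrt_mul, Real.sqrt_sq] using this

theorem ae_eventually_theta_le (hμ : MeasurePreserving shift μ μ)
    (hℓ_pos : ∀ t, 0 < ℓ t) (hM_pos : ∀ t, 0 < M t)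
    (hδ_pos : ∀ t, 0 < δ t) (hδ : Summable δ) (hε_pos : ∀ t, 0 < ε t)
    (hε : Tendsto ε atTop (𝓝 0)) :
    ∀ᵐ ω ∂μ, ∀ s : ℝ≥0, alphaNorm μ < s → ∀ᶠ t in atTop, theta ℓ n M ε δ t ω ≤ s := by
  by_cases hα : alphaNorm μ = ∞
  · exact Eventually.of_forall fun ω s hs => absurd hs (by simp [hα])
  filter_upwards [ae_tendsto_sqDev (n := n) hμ hα hℓ_pos hM_pos hδ_pos hδ hε_pos hε]
    with ω hω s hs
  have h1 := (hω.const_mul 3).const_add (alphaNorm μ).toReal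
  rw [mul_zero, add_zero] at h1
  have h2 : (alphaNorm μ).toReal < s := (ENNReal.toReal_lt_toReal hα ENNReal.coe_ne_top).2 hs
  filter_upwards [h1.eventually_lt_const h2] with t ht
  exact (sum_alphaHat_le hμ hα ω _ (n t) (ℓ t) (M t)).trans ht.le

end Parameters

/-! ### From the tests to the estimator -/

section Estimator

variable {ℓ n M : ℕ → ℕ} {ε δ : ℕ → ℝ} {u : ℕ → ℝ≥0} {ω : Path} {s : ℝ≥0} {T₀ : ℕ}

/-- The bit keeps only the latest outcome, so one test after `T₀` suffices. The condition `1 ≤ i` is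
there because no test takes place at time `0`. -/
theorem bit_eq_zero
    (h : ∀ i, T₀ ≤ i → u i = s → (s : ℝ) + ε i * √(s : ℝ) < theta ℓ n M ε δ i ω) {t : ℕ}
    (ht : ∃ i, 1 ≤ i ∧ T₀ ≤ i ∧ i ≤ t ∧ u i = s) : bit ℓ n M ε δ u ω t s = 0 := by
  induction t with
  | zero => obtain ⟨i, h1, -, h2, -⟩ := ht; omega
  | succ t ih =>
    obtain ⟨i, h1, h2, h3, h4⟩ := ht
    rw [bit]
    by_cases hu : u (t + 1) = s
    · rw [if_pos hu, if_neg (not_le.2 (h _ (h2.trans h3) hu))]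
    · rw [if_neg hu]
      refine ih ⟨i, h1, h2, ?_, h4⟩
      rcases Nat.le_succ_iff.1 h3 with h5 | h5
      · exact h5
      · subst h5; exact absurd h4 hu

theorem bit_eq_one
    (h : ∀ i, T₀ ≤ i → u i = s → theta ℓ n M ε δ i ω ≤ (s : ℝ) + ε i * √(s : ℝ)) {t : ℕ}
    (ht : ∃ i, 1 ≤ i ∧ T₀ ≤ i ∧ i ≤ t ∧ u i = s) : bit ℓ n M ε δ u ω t s = 1 := by
  induction t with
  | zero => obtain ⟨i, h1, -, h2, -⟩ := ht; omega
  | succ t ih =>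
    obtain ⟨i, h1, h2, h3, h4⟩ := ht
    rw [bit]
    by_cases hu : u (t + 1) = s
    · rw [if_pos hu, if_pos (h _ (h2.trans h3) hu)]
    · rw [if_neg hu]
      refine ih ⟨i, h1, h2, ?_, h4⟩
      rcases Nat.le_succ_iff.1 h3 with h5 | h5
      · exact h5
      · subst h5; exact absurd h4 hu

/-- The estimator converges to `L` if the sums of the empirical coefficients are eventually above
every number below `L` and below every number above `L`. -/
theorem tendsto_xi {S : Set ℝ≥0} (hS : Dense S) (hε_pos : ∀ t, 0 < ε t)
    (hε : Tendsto ε atTop (𝓝 0)) (hu_mem : ∀ t, u t ∈ S) (hu : ∀ s ∈ S, {t | u t = s}.Infinite)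
    {L : ℝ≥0∞} (hlow : ∀ K : ℝ≥0, K < L → ∀ᶠ t in atTop, (K : ℝ) < theta ℓ n M ε δ t ω)
    (hup : ∀ K : ℝ≥0, L < K → ∀ᶠ t in atTop, theta ℓ n M ε δ t ω ≤ K) :
    Tendsto (fun t => xi ℓ n M ε δ S u t ω) atTop (𝓝 L) := by
  have hrec : ∀ s ∈ S, ∀ T, ∃ i, T ≤ i ∧ u i = s := fun s hs T => by
    obtain ⟨i, hi, hT⟩ := (hu s hs).exists_gt T
    exact ⟨i, hT.le, hi⟩
  refine tendsto_order.2 ⟨fun a ha => ?_, fun b hb => ?_⟩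
  · obtain ⟨r₂, har, hr₂⟩ := ENNReal.lt_iff_exists_nnreal_btwn.1 ha
    obtain ⟨r₁, har₁, hr₁₂⟩ := ENNReal.lt_iff_exists_nnreal_btwn.1 har
    have hr : (r₁ : ℝ) < r₂ := by exact_mod_cast hr₁₂
    have hlim : Tendsto (fun t => (r₁ : ℝ) + ε t * √(r₁ : ℝ)) atTop (𝓝 (r₁ : ℝ)) := by
      simpa using (hε.mul_const √(r₁ : ℝ)).const_add (r₁ : ℝ)
    obtain ⟨T₁, hT₁⟩ := eventually_atTop.1 ((hlow r₂ hr₂).and (hlim.eventually_lt_const hr))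
    set T₀ := max T₁ 1
    -- The acceptance level is increasing in `s`, so the gap between `r₁` and `r₂` absorbs the
    -- tolerance for all `s ≤ r₁` at once.
    have htest : ∀ s ≤ r₁, ∀ i, T₀ ≤ i → u i = s →
        (s : ℝ) + ε i * √(s : ℝ) < theta ℓ n M ε δ i ω := by
      intro s hs i hi _
      obtain ⟨h1, h2⟩ := hT₁ i ((le_max_left _ _).trans hi)
      have hs' : (s : ℝ) ≤ r₁ := by exact_mod_cast hs
      have h3 : ε i * √(s : ℝ) ≤ ε i * √(r₁ : ℝ) :=
        mul_le_mul_of_nonneg_left (Real.sqrt_le_sqrt hs') (hε_pos i).le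
      linarith
    -- Thresholds tested before `T₀` may still carry an outdated acceptance; there are finitely
    -- many, and each is eventually tested again.
    have hagain : ∀ᶠ t in atTop, ∀ i ∈ Finset.range T₀, ∃ i', T₀ ≤ i' ∧ i' ≤ t ∧ u i' = u i := by
      refine (eventually_all_finset _).2 fun i _ => ?_
      obtain ⟨i', h1, h2⟩ := hrec (u i) (hu_mem i) T₀
      filter_upwards [eventually_ge_atTop i'] with t ht
      exact ⟨i', h1, ht, h2⟩
    filter_upwards [hagain, eventually_ge_atTop 1] with t ht ht1
    refine har₁.trans_le ?_
    rw [xi, if_neg (by omega)]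
    refine le_iInf fun s => le_iInf fun _ => le_iInf fun hts => le_iInf fun hbit => ?_
    by_contra hlt
    rw [not_le, ENNReal.coe_lt_coe] at hlt
    have h0 : bit ℓ n M ε δ u ω t s = 0 := by
      refine bit_eq_zero (htest s hlt.le) ?_
      obtain ⟨i, hi1, hit, his⟩ := hts
      rcases lt_or_ge i T₀ with hi | hi
      · obtain ⟨i', h1, h2, h3⟩ := ht i (Finset.mem_range.2 hi)
        exact ⟨i', (le_max_right _ _).trans h1, h1, h2, h3.trans his⟩
      · exact ⟨i, hi1, hi, hit, his⟩
    omega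
  · obtain ⟨r₂, hLr, hr₂⟩ := ENNReal.lt_iff_exists_nnreal_btwn.1 hb
    obtain ⟨r₁, hLr₁, hr₁₂⟩ := ENNReal.lt_iff_exists_nnreal_btwn.1 hLr
    obtain ⟨s, hs, hs₁, hs₂⟩ := hS.exists_between (ENNReal.coe_lt_coe.1 hr₁₂)
    obtain ⟨T₀, hT₀⟩ := eventually_atTop.1 (hup s (hLr₁.trans (ENNReal.coe_lt_coe.2 hs₁)))
    obtain ⟨i, hi, his⟩ := hrec s hs (max T₀ 1)
    filter_upwards [eventually_ge_atTop i] with t ht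
    have hi1 : 1 ≤ i := (le_max_right _ _).trans hi
    have hbit : bit ℓ n M ε δ u ω t s = 1 := by
      refine bit_eq_one (T₀ := T₀) (fun i hi _ => (hT₀ i hi).trans ?_)
        ⟨i, hi1, (le_max_left _ _).trans hi, ht, his⟩
      exact le_add_of_nonneg_right (mul_nonneg (hε_pos i).le (Real.sqrt_nonneg _))
    rw [xi, if_neg (by omega)]
    refine lt_of_le_of_lt ?_ ((ENNReal.coe_lt_coe.2 hs₂).trans hr₂)
    exact iInf_le_of_le s (iInf_le_of_le hs (iInf_le_of_le ⟨i, hi1, ht, his⟩ (iInf_le _ hbit)))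

end Estimator

end AlphaMixing

theorem mainTheorem1
    (μ : Measure AlphaMixing.Path) [IsProbabilityMeasure μ]
    (hμ : Ergodic AlphaMixing.shift μ)
    (ℓ n M : ℕ → ℕ) (ε δ : ℕ → ℝ)
    (hℓ_pos : ∀ t, 0 < ℓ t) (hℓ_mono : Monotone ℓ) (hℓ : Tendsto ℓ atTop atTop)
    (hn_pos : ∀ t, 0 < n t) (hn_mono : Monotone n) (hn : Tendsto n atTop atTop)
    (hM_pos : ∀ t, 0 < M t) (hM_mono : Monotone M) (hM : Tendsto M atTop atTop)
    (hδ_pos : ∀ t, 0 < δ t) (hδ : Summable δ)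
    (hε_pos : ∀ t, 0 < ε t) (hε : Tendsto ε atTop (𝓝 0))
    (S : Set ℝ≥0) (hS_count : S.Countable) (hS_dense : Dense S)
    (u : ℕ → ℝ≥0) (hu_mem : ∀ t, u t ∈ S) (hu : ∀ s ∈ S, {t | u t = s}.Infinite) :
    ∀ᵐ ω ∂μ, Tendsto (fun t => AlphaMixing.xi ℓ n M ε δ S u t ω) atTop
      (𝓝 (AlphaMixing.alphaNorm μ)) := by
  filter_upwards [AlphaMixing.ae_exists_freq_near hμ,
    AlphaMixing.ae_eventually_theta_le (n := n) hμ.toMeasurePreserving hℓ_pos hM_pos hδ_pos hδ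
      hε_pos hε] with ω hlow hup
  refine AlphaMixing.tendsto_xi hS_dense hε_pos hε hu_mem hu (fun K hK => ?_) hup
  exact AlphaMixing.eventually_lt_sum_alphaHat hμ.toMeasurePreserving hlow
    (AlphaMixing.tendsto_kappa hM_pos hδ_pos hδ hε_pos hε) hn hℓ hM
    (by rwa [ENNReal.ofReal_coe_nnreal])
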